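/- Let $\mathbb{H}=\{\tau\in\mathbb{C} : \operatorname{Im}\tau>0\}$, $\mathcal{Q}=e^{2\pi i\tau}$, let $\eta$ be the Dedekind eta function, and for $k\ge 1$ let $$E_{2k}(\tau)=1-\frac{4k}{B_{2k}}\sum_{n\ge 1}\frac{n^{2k-1}\mathcal{Q}^n}{1-\mathcal{Q}^n}$$ with Bernoulli numbers $B_{2k}$. Let $$A(\tau)=\left(\frac{\eta(\tau)^9}{\eta(3\tau)^3}+27\frac{\eta(3\tau)^9}{\eta(\tau)^3}\right)^{1/3},\qquad B(\tau)=\tfrac14\big(E_2(\tau)+3E_2(3\tau)\big),\qquad C(\tau)=\frac{\eta(\tau)^9}{\eta(3\tau)^3},$$ where the cube root is the unique one that is holomorphic on $\mathbb{H}$ and tends to $1$ as $\operatorname{Im}\tau\to\infty$ (it exists). Let $X=(1+27q)^{-1}$, $I_{11}=q\frac{d}{dq}\Big(\log q+3\sum_{k\ge1}\frac{(3k-1)!}{(k!)^3}(-1)^kq^k\Big)$ and $S=q\frac{d}{dq}\big(\log I_{11}-\frac13\log X\big)$ near $q=0$, where $q$ is the function of $\tau$ determined by $\frac{1}{1+27q}=1+27\frac{\eta(3\tau)^{12}}{\eta(\tau)^{12}}$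 (so $q\to0$ as $\operatorname{Im}\tau\to\infty$). Viewed as functions of $\tau$ near $i\infty$, $I_{11}$ and $S$ continue (uniquely) to holomorphic functions on $\mathbb{H}$, denoted by the same letters. Then the rings $\mathbb{Q}[E_2(3\tau),E_4(3\tau),E_6(3\tau)]$ and $\mathbb{Q}[A,B,C]$ of functions on $\mathbb{H}$ are graded by the weight, where $E_{2k}(3\tau)$ has weight $2k$ and $A,B,C$ have weights $1,2,3$, and there is the embedding of graded rings $$\mathbb{Q}[E_2(3\tau),E_4(3\tau),E_6(3\tau)]\subset\mathbb{Q}[A(\tau),B(\tau),C(\tau)].$$ Explicitly, for all $\tau\in\mathbb{H}$ (and, for the expressions in $I_{11},X,S$, for all $\tau$ with $X(\tau)\ne0$, i.e. $q(\tau)\neq\infty$), $$3E_2(3\tau)=2B+A^2=\frac{3I_{11}^2}{X}(X+4S),$$ $$9E_4(3\tau)=A^4+8AC=\frac{I_{11}^4}{X}(X+8),$$ $$27E_6(3\tau)=-A^6+20A^3C+8C^2=\frac{-I_{11}^6}{X^2}(X^2-20X-8).$$ -/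

import Mathlib

open scoped Manifold Topology Nat UpperHalfPlane

noncomputable section

namespace LocalP2

/-! ### Eisenstein series and the functions `A`, `B`, `C` on the upper half-plane -/

/-- `𝒬 = exp(2πiτ)`. -/
def nome (τ : ℂ) : ℂ := Complex.exp (2 * Real.pi * Complex.I * τ)

/-- `E_{2k}(τ) = 1 - (4k / B_{2k}) ∑_{n ≥ 1} n^{2k-1} 𝒬^n / (1 - 𝒬^n)`, meant for `k ≥ 1` and
`Im τ > 0`. -/
def eisenstein (k : ℕ) (τ : ℂ) : ℂ :=
  1 - (4 * k / (bernoulli (2 * k) : ℂ)) *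
    ∑' n : ℕ+, ((n : ℕ) : ℂ) ^ (2 * k - 1) * nome τ ^ (n : ℕ) / (1 - nome τ ^ (n : ℕ))

/-- `C(τ) = η(τ)^9 / η(3τ)^3`. -/
def funC (τ : ℍ) : ℂ :=
  ModularForm.eta τ ^ 9 / ModularForm.eta (3 * τ) ^ 3

/-- `B(τ) = (E_2(τ) + 3 E_2(3τ)) / 4`. -/
def funB (τ : ℍ) : ℂ :=
  (1 / 4) * (eisenstein 1 τ + 3 * eisenstein 1 (3 * τ))

/-- `A(τ) = (η(τ)^9 / η(3τ)^3 + 27 η(3τ)^9 / η(τ)^3)^{1/3}`: the cube root which is holomorphic on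
the upper half-plane and has constant term `1` in its `𝒬`-expansion. -/
structure IsFunA (A : ℍ → ℂ) : Prop where
  holomorphic : MDifferentiable 𝓘(ℂ) 𝓘(ℂ) A
  cube : ∀ τ : ℍ, A τ ^ 3 =
    ModularForm.eta τ ^ 9 / ModularForm.eta (3 * τ) ^ 3 +
      27 * (ModularForm.eta (3 * τ) ^ 9 / ModularForm.eta τ ^ 3)
  tendsto_one : Filter.Tendsto A UpperHalfPlane.atImInfty (𝓝 1)

/-! ### The generators `X`, `I₁₁`, `S`, as functions of `q` near `q = 0` -/

/-- `X = (1 + 27 q)^{-1}`. -/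
def genX (q : ℂ) : ℂ := (1 + 27 * q)⁻¹

/-- `Ī₁(q) = 3 ∑_{k ≥ 1} (3k-1)! / (k!)^3 (-1)^k q^k`, the power series part of the mirror map
`I₁ = log q + Ī₁`. -/
def barI1 (q : ℂ) : ℂ :=
  3 * ∑' k : ℕ+, ((3 * (k : ℕ) - 1)! : ℂ) / ((k : ℕ)! : ℂ) ^ 3 * (-1) ^ (k : ℕ) * q ^ (k : ℕ)

/-- `I₁₁ = q dI₁/dq = q d/dq (log q + Ī₁) = 1 + q dĪ₁/dq`. -/
def genI11 (q : ℂ) : ℂ := 1 + q * deriv barI1 q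

/-- `S = q d/dq (log I₁₁ - (1/3) log X)`; the derivative of a logarithm does not depend on the
branch. -/
def genS (q : ℂ) : ℂ := q * (logDeriv genI11 q - (1 / 3) * logDeriv genX q)

/-! ### The coordinate `q` as a function of `τ` -/

/-- The coordinate `q` on the modular curve, as a function of `τ`:
`1 / (1 + 27 q) = 1 + 27 η(3τ)^12 / η(τ)^12`. The right-hand side is zero exactly where `q = ∞`. -/
def coordQ (τ : ℍ) : ℂ :=
  ((1 + 27 * (ModularForm.eta (3 * τ) ^ 12 / ModularForm.eta τ ^ 12))⁻¹ - 1) / 27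

/-- `F` is the function `f` of `q`, given near `q = 0` (the cusp `τ = i∞`), viewed as a function
of `τ`: it is holomorphic on the upper half-plane and equals `f(q(τ))` near the cusp. -/
structure IsContinuation (f : ℂ → ℂ) (F : ℍ → ℂ) : Prop where
  holomorphic : MDifferentiable 𝓘(ℂ) 𝓘(ℂ) F
  eq_near_cusp : ∀ᶠ τ in UpperHalfPlane.atImInfty, F τ = f (coordQ τ)

/-! ### Rings of functions generated by weighted generators -/

/-- The ring `ℚ[f₀, f₁, f₂]` of functions on the upper half-plane. -/
def genRing (f : Fin 3 → ℍ → ℂ) : Subalgebra ℚ (ℍ → ℂ) := Algebra.adjoin ℚ (Set.range f)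

/-- The part of weight `k` of `ℚ[f₀, f₁, f₂]`, where `f i` has weight `w i`: the functions that are
weighted homogeneous polynomials of weight `k` in the `f i`. -/
def genPart (w : Fin 3 → ℕ) (f : Fin 3 → ℍ → ℂ) (k : ℕ) : Submodule ℚ (genRing f) :=
  ((MvPolynomial.weightedHomogeneousSubmodule ℚ w k).map
    (MvPolynomial.aeval (R := ℚ) f).toLinearMap).comap (genRing f).val.toLinearMap

/-- `E_2(3τ)`, `E_4(3τ)`, `E_6(3τ)`. -/
def eisGens : Fin 3 → ℍ → ℂ :=
  ![fun τ => eisenstein 1 (3 * τ), fun τ => eisenstein 2 (3 * τ), fun τ => eisenstein 3 (3 * τ)]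

end LocalP2

end

noncomputable section

namespace LocalP2

open Complex hiding eta
open UpperHalfPlane hiding I
open EisensteinSeries ModularForm Filter

/-! ### Functions of the nome on the unit disc -/

/-! Every function involved is a holomorphic function of the nome `z` on the unit disc. Put P =
(3E₂(3τ) - E₂(τ))/2, D = η(3τ)⁹/η(τ)³ and G = C + 27D. Each polynomial identity is brought to weight
6 and level 3, where it follows from the vanishing criterion `eqOn_zero_of_fricke`: it suffices to
know how both sides transform under τ ↦ -1/τ, that they agree to first order at i∞, and that their
transforms agree at the other cusp. The criterion takes the norm to level one and divides by Δ².

The first such identity is P³ = G², so A = G/P satisfies A² = P and A³ = G, and extends over the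
zeros of P. This constructs the cube root. The formulas for E₄(3τ), E₆(3τ) and the derivative of B
come from the criterion in the same way; the formula for E₂(3τ) is linear algebra once A² = P.

Logarithmic derivatives of η then give `z d/dz` of A, B and C in terms of A, B and C. Since 1 + 27q
= C/A³, this yields z dq/dz = qC/A, and A as a function of q solves the second-order equation of ∑
(-1)^k (3k)!/(k!)³ q^k, which is I₁₁. A Wronskian argument (`hyp_discQ`) identifies the two
solutions near the cusp. Hence I₁₁ = A and S = A(B - A²)/(6C), and with X = A³/C the formulas in
I₁₁, X, S are algebra.

For the gradings the issue is that a sum of functions of different weights vanishes only if each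
term does, although B is only quasimodular. The Fricke involution multiplies weight k by (cτ)^k and
shifts B by a multiple of 1/τ; periodicity allows 1/τ to be replaced by a free variable. Applying
the involution twice with different parameters produces an arbitrary scaling ρ^k of the weights
(`aeval_eq_zero_of_sum_eq_zero`). The Eisenstein ring inherits independence through its polynomial
expressions in A, B and C. -/

lemma nome_eq_qParam (τ : ℂ) : nome τ = Function.Periodic.qParam 1 τ := by
  simp [nome, Function.Periodic.qParam]

lemma norm_nome_lt_one {τ : ℂ} (hτ : 0 < τ.im) : ‖nome τ‖ < 1 :=
  norm_exp_two_pi_I_lt_one ⟨τ, hτ⟩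

lemma nome_mem_ball {τ : ℂ} (hτ : 0 < τ.im) : nome τ ∈ Metric.ball (0 : ℂ) 1 := by
  simpa using norm_nome_lt_one hτ

lemma nome_three_mul (τ : ℂ) : nome (3 * τ) = nome τ ^ 3 := by
  rw [nome, nome, ← exp_nat_mul]; congr 1; push_cast; ring

lemma nome_add_one (τ : ℂ) : nome (τ + 1) = nome τ := by
  rw [nome, mul_add, mul_one, exp_add, exp_two_pi_mul_I, mul_one, nome]

lemma nome_add_nat (τ : ℂ) (n : ℕ) : nome (τ + n) = nome τ := by
  induction n with
  | zero => simp
  | succ n ih => rw [Nat.cast_succ, ← add_assoc, nome_add_one, ih]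

lemma exists_nome_eq {z : ℂ} (hz : z ∈ Metric.ball (0 : ℂ) 1) (hz0 : z ≠ 0) :
    ∃ τ : ℂ, 0 < τ.im ∧ nome τ = z := by
  refine ⟨Function.Periodic.invQParam 1 z,
    Function.Periodic.im_invQParam_pos_of_norm_lt_one one_pos (by simpa using hz) hz0, ?_⟩
  rw [nome_eq_qParam, Function.Periodic.qParam_right_inv one_ne_zero hz0]

lemma hasDerivAt_nome (τ : ℂ) : HasDerivAt nome (2 * Real.pi * I * nome τ) τ := by
  have h := ((hasDerivAt_id τ).const_mul (2 * Real.pi * I : ℂ)).cexp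
  simp only [id, mul_one, mul_comm (cexp _)] at h
  exact h

lemma tendsto_nome_atImInfty : Tendsto (fun τ : ℍ => nome τ) atImInfty (𝓝 0) := by
  simpa only [nome_eq_qParam] using qParam_tendsto_atImInfty one_pos

/-- `E₂` as a function of the nome. -/
def discE2 : ℂ → ℂ := cuspFunction 1 E2

/-- `E₄` as a function of the nome. -/
def discE4 : ℂ → ℂ := cuspFunction 1 E₄

/-- `E₆` as a function of the nome. -/
def discE6 : ℂ → ℂ := cuspFunction 1 E₆

/-- The Euler product `∏ (1 - z ^ (n + 1))`. -/
def eulerProd (z : ℂ) : ℂ := ∏' n : ℕ, (1 - z ^ (n + 1))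

lemma periodic_E2 : Function.Periodic (E2 ∘ ofComplex) (1 : ℝ) := by
  intro τ
  by_cases hτ : 0 < τ.im
  · have h1 : 0 < (τ + (1 : ℝ)).im := by simpa using hτ
    simp only [Function.comp_apply, ofComplex_apply_of_im_pos hτ, ofComplex_apply_of_im_pos h1,
      E2_eq_tsum_cexp]
    congr 3
    ext n
    have := nome_add_one τ
    simp only [nome] at this
    simp [this]
  · have h1 : ¬ 0 < (τ + (1 : ℝ)).im := by simpa using hτ
    simp only [Function.comp_apply, ofComplex_apply_of_im_nonpos (not_lt.mp hτ),
      ofComplex_apply_of_im_nonpos (not_lt.mp h1)]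

lemma differentiableOn_discE2 : DifferentiableOn ℂ discE2 (Metric.ball 0 1) :=
  differentiableOn_cuspFunction_ball one_pos periodic_E2 E2_mdifferentiable isBoundedAtImInfty_E2

lemma differentiableOn_discE4 : DifferentiableOn ℂ discE4 (Metric.ball 0 1) := fun _ hz =>
  (ModularFormClass.differentiableAt_cuspFunction E₄ one_pos one_mem_strictPeriods_SL
    (by simpa using hz)).differentiableWithinAt

lemma differentiableOn_discE6 : DifferentiableOn ℂ discE6 (Metric.ball 0 1) := fun _ hz =>
  (ModularFormClass.differentiableAt_cuspFunction E₆ one_pos one_mem_strictPeriods_SL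
    (by simpa using hz)).differentiableWithinAt

lemma discE2_nome (τ : ℍ) : discE2 (nome τ) = E2 τ := by
  rw [discE2, nome_eq_qParam]
  simpa using eq_cuspFunction τ one_ne_zero periodic_E2

lemma discE4_nome (τ : ℍ) : discE4 (nome τ) = E₄ τ := by
  rw [discE4, nome_eq_qParam]
  simpa using SlashInvariantFormClass.eq_cuspFunction E₄ τ one_mem_strictPeriods_SL one_ne_zero

lemma discE6_nome (τ : ℍ) : discE6 (nome τ) = E₆ τ := by
  rw [discE6, nome_eq_qParam]
  simpa using SlashInvariantFormClass.eq_cuspFunction E₆ τ one_mem_strictPeriods_SL one_ne_zero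

lemma hasFPowerSeries_discE2 : HasFPowerSeriesOnBall discE2
    (.ofScalars ℂ fun m : ℕ => (if m = 0 then 1 else -24 * ArithmeticFunction.sigma 1 m : ℂ))
    0 1 := by
  refine hasFPowerSeriesOnBall_cuspFunction one_pos
    (analyticAt_cuspFunction_zero one_pos periodic_E2 E2_mdifferentiable isBoundedAtImInfty_E2)
    fun τ => ?_
  simpa only [Function.Periodic.qParam, ofReal_one, div_one] using hasSum_qExpansion_E2 (z := τ)

lemma discE2_zero : discE2 0 = 1 := by
  have := hasFPowerSeries_discE2.coeff_zero (fun i => 0)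
  simpa [FormalMultilinearSeries.ofScalars] using this.symm

lemma hasDerivAt_discE2_zero : HasDerivAt discE2 (-24) 0 := by
  have := hasFPowerSeries_discE2.hasFPowerSeriesAt.hasDerivAt
  simpa [FormalMultilinearSeries.ofScalars] using this

lemma discE4_zero : discE4 0 = 1 := by
  have := E_qExpansion_coeff_zero (k := 4) (by norm_num) (by decide)
  simp only [qExpansion_coeff, Nat.factorial_zero, Nat.cast_one, inv_one, iteratedDeriv_zero,
    one_mul] at this
  exact this

lemma discE6_zero : discE6 0 = 1 := by
  have := E_qExpansion_coeff_zero (k := 6) (by norm_num) (by decide)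
  simp only [qExpansion_coeff, Nat.factorial_zero, Nat.cast_one, inv_one, iteratedDeriv_zero,
    one_mul] at this
  exact this

lemma eisenstein_one (τ : ℍ) : eisenstein 1 τ = discE2 (nome τ) := by
  rw [discE2_nome, E2_eq_tsum_cexp,
    ← tsum_pow_div_one_sub_eq_tsum_sigma (norm_exp_two_pi_I_lt_one τ)]
  simp [eisenstein, nome, bernoulli_two]
  norm_num

lemma eisenstein_two (τ : ℍ) : eisenstein 2 τ = discE4 (nome τ) := by
  have h := q_expansion_bernoulli (k := 4) (by norm_num) (by decide) τ
  simp only [zpow_natCast] at h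
  rw [discE4_nome, E₄, h, ← tsum_pow_div_one_sub_eq_tsum_sigma (norm_exp_two_pi_I_lt_one τ)]
  simp [eisenstein, nome]
  norm_num

lemma eisenstein_three (τ : ℍ) : eisenstein 3 τ = discE6 (nome τ) := by
  have h := q_expansion_bernoulli (k := 6) (by norm_num) (by decide) τ
  simp only [zpow_natCast] at h
  rw [discE6_nome, E₆, h, ← tsum_pow_div_one_sub_eq_tsum_sigma (norm_exp_two_pi_I_lt_one τ)]
  simp [eisenstein, nome]
  norm_num

/-! ### The Euler product and the eta quotients C and D on the disc. -/

lemma differentiableOn_eulerProd : DifferentiableOn ℂ eulerProd (Metric.ball 0 1) :=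
  differentiableOn_tprod_one_sub_pow

lemma eulerProd_zero : eulerProd 0 = 1 := by simp [eulerProd]

lemma eta_eq_mul_eulerProd (τ : ℂ) :
    eta τ = Function.Periodic.qParam 24 τ * eulerProd (nome τ) := by
  simp [eta, eulerProd, eta_q, nome_eq_qParam]

/-- Away from 0 every point of the disc is a nome, so this is the nonvanishing of η. -/
lemma eulerProd_ne_zero {z : ℂ} (hz : z ∈ Metric.ball (0 : ℂ) 1) : eulerProd z ≠ 0 := by
  rcases eq_or_ne z 0 with rfl | h0
  · simp [eulerProd_zero]
  · obtain ⟨τ, hτ, rfl⟩ := exists_nome_eq hz h0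
    have := eta_ne_zero hτ
    rw [eta_eq_mul_eulerProd] at this
    exact right_ne_zero_of_mul this

/-- `η(τ)^9 / η(3τ)^3` as a function of the nome. -/
def discC (z : ℂ) : ℂ := eulerProd z ^ 9 / eulerProd (z ^ 3) ^ 3

/-- `η(3τ)^9 / η(τ)^3` as a function of the nome. -/
def discD (z : ℂ) : ℂ := z * eulerProd (z ^ 3) ^ 9 / eulerProd z ^ 3

lemma qParam_pow_three (τ : ℂ) :
    Function.Periodic.qParam 24 τ ^ 24 = nome τ ∧
    Function.Periodic.qParam 24 (3 * τ) = Function.Periodic.qParam 24 τ ^ 3 := by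
  constructor <;>
  · simp only [Function.Periodic.qParam, nome, ← exp_nat_mul]
    congr 1
    push_cast
    ring

lemma discC_nome (τ : ℂ) : discC (nome τ) = eta τ ^ 9 / eta (3 * τ) ^ 3 := by
  have h0 : Function.Periodic.qParam 24 τ ≠ 0 := Function.Periodic.qParam_ne_zero _
  rw [eta_eq_mul_eulerProd, eta_eq_mul_eulerProd, (qParam_pow_three τ).2, discC, nome_three_mul,
    mul_pow, mul_pow, ← pow_mul, mul_div_mul_left _ _ (pow_ne_zero _ h0)]

lemma discD_nome (τ : ℂ) : discD (nome τ) = eta (3 * τ) ^ 9 / eta τ ^ 3 := by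
  have h0 : Function.Periodic.qParam 24 τ ≠ 0 := Function.Periodic.qParam_ne_zero _
  rw [eta_eq_mul_eulerProd, eta_eq_mul_eulerProd, (qParam_pow_three τ).2, discD, nome_three_mul,
    mul_pow, mul_pow, ← pow_mul, show 3 * 9 = 3 + 24 from rfl, pow_add, (qParam_pow_three τ).1,
    mul_assoc, mul_div_mul_left _ _ (pow_ne_zero _ h0)]

lemma pow_three_mem_ball {z : ℂ} (hz : z ∈ Metric.ball (0 : ℂ) 1) :
    z ^ 3 ∈ Metric.ball (0 : ℂ) 1 := by
  simp only [Metric.mem_ball, dist_zero_right, norm_pow] at hz ⊢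
  exact pow_lt_one₀ (norm_nonneg z) hz (by norm_num)

lemma differentiableOn_comp_pow_three {f : ℂ → ℂ} (hf : DifferentiableOn ℂ f (Metric.ball 0 1)) :
    DifferentiableOn ℂ (fun z => f (z ^ 3)) (Metric.ball 0 1) :=
  hf.comp (differentiable_pow 3).differentiableOn fun _ hz => pow_three_mem_ball hz

lemma differentiableOn_discC : DifferentiableOn ℂ discC (Metric.ball 0 1) :=
  (differentiableOn_eulerProd.pow 9).div
    ((differentiableOn_comp_pow_three differentiableOn_eulerProd).pow 3)
    fun _ hz => pow_ne_zero _ (eulerProd_ne_zero (pow_three_mem_ball hz))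

lemma differentiableOn_discD : DifferentiableOn ℂ discD (Metric.ball 0 1) :=
  (differentiableOn_id.mul ((differentiableOn_comp_pow_three differentiableOn_eulerProd).pow 9)).div
    (differentiableOn_eulerProd.pow 3) fun _ hz => pow_ne_zero _ (eulerProd_ne_zero hz)

lemma discC_ne_zero {z : ℂ} (hz : z ∈ Metric.ball (0 : ℂ) 1) : discC z ≠ 0 :=
  div_ne_zero (pow_ne_zero _ (eulerProd_ne_zero hz))
    (pow_ne_zero _ (eulerProd_ne_zero (pow_three_mem_ball hz)))

lemma discC_zero : discC 0 = 1 := by simp [discC, eulerProd_zero]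

lemma discD_zero : discD 0 = 0 := by simp [discD]

/-! ### The combinations P, B and G, with their first Taylor coefficients. -/

/-- `(3 E₂(3τ) - E₂(τ)) / 2` as a function of the nome. -/
def discP (z : ℂ) : ℂ := (3 * discE2 (z ^ 3) - discE2 z) / 2

/-- `(E₂(τ) + 3 E₂(3τ)) / 4` as a function of the nome. -/
def discB (z : ℂ) : ℂ := (discE2 z + 3 * discE2 (z ^ 3)) / 4

/-- `η(τ)^9 / η(3τ)^3 + 27 η(3τ)^9 / η(τ)^3` as a function of the nome. -/
def discG (z : ℂ) : ℂ := discC z + 27 * discD z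

lemma differentiableOn_discP : DifferentiableOn ℂ discP (Metric.ball 0 1) :=
  (((differentiableOn_comp_pow_three differentiableOn_discE2).const_mul 3).sub
    differentiableOn_discE2).div_const 2

lemma differentiableOn_discB : DifferentiableOn ℂ discB (Metric.ball 0 1) :=
  (differentiableOn_discE2.add
    ((differentiableOn_comp_pow_three differentiableOn_discE2).const_mul 3)).div_const 4

lemma differentiableOn_discG : DifferentiableOn ℂ discG (Metric.ball 0 1) :=
  differentiableOn_discC.add (differentiableOn_discD.const_mul 27)

lemma discP_zero : discP 0 = 1 := by norm_num [discP, discE2_zero]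

lemma discB_zero : discB 0 = 1 := by norm_num [discB, discE2_zero]

lemma discG_zero : discG 0 = 1 := by simp [discG, discC_zero, discD_zero]

/-- Since z³ has no linear term, functions of 3τ contribute only their constant term to first-order
comparisons at the cusp. -/
lemma hasDerivAt_comp_pow_three_zero {f : ℂ → ℂ} {f' : ℂ} (hf : HasDerivAt f f' 0) :
    HasDerivAt (fun z => f (z ^ 3)) 0 0 := by
  have h := HasDerivAt.comp (0 : ℂ) (h₂ := f) (h := fun z => z ^ 3) (h₂' := f') (by simpa using hf)
    (hasDerivAt_pow 3 0)
  simpa [Function.comp_def] using h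

lemma hasDerivAt_discP_zero : HasDerivAt discP 12 0 := by
  have := (((hasDerivAt_comp_pow_three_zero hasDerivAt_discE2_zero).const_mul 3).sub
    hasDerivAt_discE2_zero).div_const 2
  convert! this using 1
  norm_num

lemma hasDerivAt_discB_zero : HasDerivAt discB (-6) 0 := by
  have := (hasDerivAt_discE2_zero.add
    ((hasDerivAt_comp_pow_three_zero hasDerivAt_discE2_zero).const_mul 3)).div_const 4
  convert! this using 1
  norm_num

/-! ### Behaviour under `τ ↦ -1 / τ` -/

lemma im_neg_one_div_pos {τ : ℂ} (hτ : 0 < τ.im) : 0 < (-1 / τ).im := by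
  have := UpperHalfPlane.im_inv_neg_coe_pos ⟨τ, hτ⟩
  simpa [neg_div, inv_neg] using this

lemma im_div_three_pos {τ : ℂ} (hτ : 0 < τ.im) : 0 < (τ / 3).im := by
  have : (τ / 3).im = τ.im / 3 := by
    simp
  rw [this]; positivity

lemma coe_S_smul (τ : ℍ) : ((ModularGroup.S • τ : ℍ) : ℂ) = -1 / (τ : ℂ) := by
  rw [UpperHalfPlane.modular_S_smul]
  simp [neg_div, inv_neg]

lemma discE2_nome_neg_one_div {τ : ℂ} (hτ : 0 < τ.im) :
    discE2 (nome (-1 / τ)) = τ ^ 2 * discE2 (nome τ) + 6 * τ / (Real.pi * I) := by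
  lift τ to ℍ using hτ
  have h := congrFun (E2_slash_action ModularGroup.S) τ
  have h0 : (τ : ℂ) ≠ 0 := τ.ne_zero
  have hpi : (Real.pi : ℂ) ≠ 0 := by exact_mod_cast Real.pi_ne_zero
  rw [SL_slash_apply, ModularGroup.denom_S, Pi.sub_apply, Pi.smul_apply, D2_S, riemannZeta_two,
    ← discE2_nome, ← discE2_nome, coe_S_smul] at h
  rw [zpow_neg, mul_inv_eq_iff_eq_mul₀ (zpow_ne_zero _ h0)] at h
  rw [h, smul_eq_mul]
  field_simp
  ring_nf
  simp only [I_sq]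
  ring

lemma discE4_nome_neg_one_div {τ : ℂ} (hτ : 0 < τ.im) :
    discE4 (nome (-1 / τ)) = τ ^ 4 * discE4 (nome τ) := by
  lift τ to ℍ using hτ
  have h : ((⇑E₄) ∣[(4 : ℤ)] ModularGroup.S) τ = E₄ τ :=
    congrFun (SlashInvariantForm.slash_action_eqn E₄ _ (MonoidHom.mem_range.mpr ⟨_, rfl⟩)) τ
  rw [SL_slash_apply, ModularGroup.denom_S, zpow_neg,
    mul_inv_eq_iff_eq_mul₀ (zpow_ne_zero _ τ.ne_zero)] at h
  rw [← coe_S_smul, discE4_nome, discE4_nome, h, mul_comm]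
  norm_cast

lemma discE6_nome_neg_one_div {τ : ℂ} (hτ : 0 < τ.im) :
    discE6 (nome (-1 / τ)) = τ ^ 6 * discE6 (nome τ) := by
  lift τ to ℍ using hτ
  have h : ((⇑E₆) ∣[(6 : ℤ)] ModularGroup.S) τ = E₆ τ :=
    congrFun (SlashInvariantForm.slash_action_eqn E₆ _ (MonoidHom.mem_range.mpr ⟨_, rfl⟩)) τ
  rw [SL_slash_apply, ModularGroup.denom_S, zpow_neg,
    mul_inv_eq_iff_eq_mul₀ (zpow_ne_zero _ τ.ne_zero)] at h
  rw [← coe_S_smul, discE6_nome, discE6_nome, h, mul_comm]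
  norm_cast

lemma nome_neg_one_div_pow_three {τ : ℂ} : nome (-1 / τ) ^ 3 = nome (-1 / (τ / 3)) := by
  rw [← nome_three_mul]; congr 1; rw [div_div_eq_mul_div]; ring

lemma nome_div_three_pow_three (τ : ℂ) : nome (τ / 3) ^ 3 = nome τ := by
  rw [← nome_three_mul]; congr 1; ring

lemma discP_nome_neg_one_div {τ : ℂ} (hτ : 0 < τ.im) :
    discP (nome (-1 / τ)) = -τ ^ 2 * discP (nome (τ / 3)) / 3 := by
  rw [discP, nome_neg_one_div_pow_three, discE2_nome_neg_one_div hτ,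
    discE2_nome_neg_one_div (im_div_three_pos hτ), discP, nome_div_three_pow_three]
  ring

lemma discB_nome_neg_one_div {τ : ℂ} (hτ : 0 < τ.im) :
    discB (nome (-1 / τ)) = τ ^ 2 * discB (nome (τ / 3)) / 3 + 3 * τ / (Real.pi * I) := by
  rw [discB, nome_neg_one_div_pow_three, discE2_nome_neg_one_div hτ,
    discE2_nome_neg_one_div (im_div_three_pos hτ), discB, nome_div_three_pow_three]
  ring

lemma csqrt_sq (w : ℂ) : sqrt w ^ 2 = w := by
  rw [sqrt, ← cpow_nat_mul]; simp

/-- A positive real factor does not move the argument, so the principal logarithm is additive here.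
-/
lemma csqrt_three_mul {w : ℂ} (hw : w ≠ 0) : sqrt (3 * w) = (Real.sqrt 3 : ℝ) * sqrt w := by
  have h3 : ((Real.sqrt 3 : ℝ) : ℂ) = sqrt 3 := by
    rw [Complex.sqrt, Real.sqrt_eq_rpow, Complex.ofReal_cpow (by norm_num)]
    simp
  have hlog : log (3 * w) = log 3 + log w := by
    simpa [Complex.ofReal_log] using Complex.log_ofReal_mul (r := 3) (by norm_num) hw
  rw [h3, sqrt_eq_exp (mul_ne_zero three_ne_zero hw), sqrt_eq_exp three_ne_zero, sqrt_eq_exp hw,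
    hlog, ← exp_add]
  congr 1
  ring

lemma sqrt_three_sq : ((Real.sqrt 3 : ℝ) : ℂ) ^ 2 = 3 := by
  norm_cast; simp

lemma sqrt_three_ne_zero : ((Real.sqrt 3 : ℝ) : ℂ) ≠ 0 := by
  intro h; have := sqrt_three_sq; rw [h] at this; norm_num at this

lemma eta_neg_one_div {τ : ℂ} (hτ : 0 < τ.im) :
    eta (-1 / τ) = (sqrt I)⁻¹ * (sqrt τ * eta τ) := by
  simpa using eta_comp_eq_csqrt_I_inv hτ

/-- Both transformation factors are written through one root `x`; the quotients η⁹/η³ then involve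
only `x ^ 6`, so the choice of branch disappears. -/
lemma eta_eta_neg_one_div {τ : ℂ} (hτ : 0 < τ.im) : ∃ x : ℂ, x ^ 2 = τ / 3 / I ∧ x ≠ 0 ∧
    eta (-1 / τ) = (Real.sqrt 3 : ℝ) * x * eta τ ∧ eta (3 * (-1 / τ)) = x * eta (τ / 3) := by
  have h0 : τ ≠ 0 := by rintro rfl; simp at hτ
  have h30 : τ / 3 ≠ 0 := div_ne_zero h0 three_ne_zero
  have hx : ((sqrt I)⁻¹ * sqrt (τ / 3)) ^ 2 = τ / 3 / I := by
    rw [mul_pow, inv_pow, csqrt_sq, csqrt_sq]; ring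
  refine ⟨(sqrt I)⁻¹ * sqrt (τ / 3), hx, ?_, ?_, ?_⟩
  · intro h
    rw [h] at hx
    exact div_ne_zero h30 I_ne_zero (by rw [← hx]; simp)
  · have h : sqrt τ = (Real.sqrt 3 : ℝ) * sqrt (τ / 3) := by
      rw [← csqrt_three_mul h30]; congr 1; ring
    rw [eta_neg_one_div hτ, h]; ring
  · rw [show 3 * (-1 / τ) = -1 / (τ / 3) by field_simp, eta_neg_one_div (im_div_three_pos hτ)]; ring

lemma discC_nome_neg_one_div {τ : ℂ} (hτ : 0 < τ.im) :
    discC (nome (-1 / τ)) = I * 3 * (Real.sqrt 3 : ℝ) * τ ^ 3 * discD (nome (τ / 3)) := by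
  obtain ⟨x, hx, hx0, h1, h2⟩ := eta_eta_neg_one_div hτ
  have hη : eta (τ / 3) ≠ 0 := eta_ne_zero (im_div_three_pos hτ)
  have hr := sqrt_three_sq
  have hx6 : x ^ 6 = I * τ ^ 3 / 27 := by
    rw [show x ^ 6 = (x ^ 2) ^ 3 by ring, hx, div_pow, I_pow_three, div_neg, div_I]; ring
  have hr9 : ((Real.sqrt 3 : ℝ) : ℂ) ^ 9 = 81 * (Real.sqrt 3 : ℝ) := by
    rw [show ((Real.sqrt 3 : ℝ) : ℂ) ^ 9 = (((Real.sqrt 3 : ℝ) : ℂ) ^ 2) ^ 4 * (Real.sqrt 3 : ℝ) by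
      ring, hr]
    norm_num
  rw [discC_nome, discD_nome, h1, h2, show 3 * (τ / 3) = τ by ring, mul_pow, mul_pow, mul_pow, hr9]
  rw [show x ^ 9 = x ^ 3 * x ^ 6 by ring, hx6]
  field_simp
  ring

lemma discD_nome_neg_one_div {τ : ℂ} (hτ : 0 < τ.im) :
    discD (nome (-1 / τ)) = I * τ ^ 3 * discC (nome (τ / 3)) / (81 * (Real.sqrt 3 : ℝ)) := by
  obtain ⟨x, hx, hx0, h1, h2⟩ := eta_eta_neg_one_div hτ
  have hη : eta τ ≠ 0 := eta_ne_zero hτ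
  have hr := sqrt_three_sq
  have hr0 := sqrt_three_ne_zero
  have hx6 : x ^ 6 = I * τ ^ 3 / 27 := by
    rw [show x ^ 6 = (x ^ 2) ^ 3 by ring, hx, div_pow, I_pow_three, div_neg, div_I]; ring
  have hr3 : ((Real.sqrt 3 : ℝ) : ℂ) ^ 3 = 3 * (Real.sqrt 3 : ℝ) := by
    rw [show ((Real.sqrt 3 : ℝ) : ℂ) ^ 3 = ((Real.sqrt 3 : ℝ) : ℂ) ^ 2 * (Real.sqrt 3 : ℝ) by
      ring, hr]
  rw [discC_nome, discD_nome, h1, h2, show 3 * (τ / 3) = τ by ring, mul_pow, mul_pow, mul_pow, hr3]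
  rw [show x ^ 9 = x ^ 3 * x ^ 6 by ring, hx6]
  field_simp
  ring

lemma discG_nome_neg_one_div {τ : ℂ} (hτ : 0 < τ.im) :
    discG (nome (-1 / τ)) = I * τ ^ 3 * discG (nome (τ / 3)) / (3 * (Real.sqrt 3 : ℝ)) := by
  have hr := sqrt_three_sq
  have hr0 := sqrt_three_ne_zero
  rw [discG, discG, discC_nome_neg_one_div hτ, discD_nome_neg_one_div hτ]
  field_simp
  rw [hr]
  ring

/-! ### A vanishing criterion -/

lemma isPreconnected_upperHalfPlaneSet : IsPreconnected upperHalfPlaneSet :=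
  (convex_halfSpace_im_gt 0).isPreconnected

lemma mdifferentiable_of_differentiableOn {f : ℂ → ℂ}
    (hf : DifferentiableOn ℂ f upperHalfPlaneSet) :
    MDifferentiable 𝓘(ℂ) 𝓘(ℂ) (fun τ : ℍ => f τ) := by
  rw [UpperHalfPlane.mdifferentiable_iff]
  exact hf.congr fun z hz => by simp [ofComplex_apply_of_im_pos hz]

lemma differentiableOn_comp_nome {F : ℂ → ℂ} (hF : DifferentiableOn ℂ F (Metric.ball 0 1)) :
    DifferentiableOn ℂ (fun τ => F (nome τ)) upperHalfPlaneSet :=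
  hF.comp (fun τ _ => (hasDerivAt_nome τ).differentiableAt.differentiableWithinAt)
    fun _ hτ => nome_mem_ball hτ

/-- A holomorphic function on the upper half-plane of level one and weight zero which vanishes at
the cusp is zero. -/
lemma eq_zero_of_invariant_of_tendsto_zero {Φ : ℍ → ℂ} (hΦ : MDifferentiable 𝓘(ℂ) 𝓘(ℂ) Φ)
    (hT : ∀ τ, Φ (ModularGroup.T • τ) = Φ τ) (hS : ∀ τ, Φ (ModularGroup.S • τ) = Φ τ)
    (h0 : Tendsto Φ atImInfty (𝓝 0)) (τ : ℍ) : Φ τ = 0 := by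
  have hinv : ∀ γ : Matrix.SpecialLinearGroup (Fin 2) ℤ, Φ ∣[(0 : ℤ)] γ = Φ :=
    SlashInvariantForm.slash_action_generators_SL2Z
      (by ext τ; simpa [SL_slash_apply] using hS τ) (by ext τ; simpa [SL_slash_apply] using hT τ)
  have hzero : IsZeroAtImInfty Φ := h0
  let f : ModularForm (Matrix.SpecialLinearGroup.mapGL (R := ℤ) (n := Fin 2) ℝ).range 0 :=
    { toFun := Φ
      slash_action_eq' := fun _ ⟨γ, hγ⟩ => hγ ▸ hinv γ
      holo' := hΦ
      bdd_at_cusps' := fun {c} hc => by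
        rw [Subgroup.IsArithmetic.isCusp_iff_isCusp_SL2Z] at hc
        rw [OnePoint.isBoundedAt_iff_forall_SL2Z hc]
        intro γ _
        rw [hinv γ]
        exact hzero.isBoundedAtImInfty }
  obtain ⟨c, hc⟩ := ModularFormClass.levelOne_weight_zero_const f
  have hc' : Φ = Function.const _ c := hc
  have : c = 0 := by
    rw [hc'] at h0
    exact tendsto_nhds_unique tendsto_const_nhds h0
  rw [hc', this, Function.const_apply]

lemma discriminant_eq_nome_mul (τ : ℍ) :
    ModularForm.discriminant τ = nome τ * eulerProd (nome τ) ^ 24 := by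
  rw [ModularForm.discriminant, eta_eq_mul_eulerProd, mul_pow, (qParam_pow_three τ).1]

lemma coe_T_smul (τ : ℍ) : ((ModularGroup.T • τ : ℍ) : ℂ) = τ + 1 := by
  rw [UpperHalfPlane.modular_T_smul]; simp [add_comm]

lemma discriminant_T_smul (τ : ℍ) :
    ModularForm.discriminant (ModularGroup.T • τ) = ModularForm.discriminant τ := by
  rw [discriminant_eq_nome_mul, discriminant_eq_nome_mul, coe_T_smul, nome_add_one]

lemma discriminant_S_smul (τ : ℍ) : ModularForm.discriminant (ModularGroup.S • τ) =
    (τ : ℂ) ^ 12 * ModularForm.discriminant τ := by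
  have h := congrFun discriminant_S_invariant τ
  rw [SL_slash_apply, ModularGroup.denom_S, zpow_neg,
    mul_inv_eq_iff_eq_mul₀ (zpow_ne_zero _ τ.ne_zero)] at h
  rw [h, mul_comm]
  norm_cast

/-- Δ vanishes to order no more than one at the cusp, so a function that is `o(nome ^ 2)` remains
infinitesimal after division by Δ². -/
lemma nome_isBigO_discriminant :
    (fun τ : ℍ => nome τ) =O[atImInfty] ModularForm.discriminant := by
  refine Asymptotics.IsBigO.trans (.of_bound 1 (.of_forall fun τ => ?_)) exp_isBigO_discriminant
  simp [nome, Complex.norm_exp]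

lemma norm_nome_add_div_three (τ : ℂ) {j : ℂ} (hj : j.im = 0) :
    ‖nome ((τ + j) / 3)‖ = ‖nome (τ / 3)‖ := by
  simp [nome, Complex.norm_exp, hj]

lemma tendsto_nome_div_three : Tendsto (fun τ : ℍ => nome (τ / 3)) atImInfty (𝓝 0) := by
  have h : Tendsto (fun τ : ℍ => nome (τ / 3) ^ 3) atImInfty (𝓝 0) := by
    simpa only [nome_div_three_pow_three] using tendsto_nome_atImInfty
  rw [tendsto_zero_iff_norm_tendsto_zero] at h ⊢
  have h' := h.rpow_const (p := 1 / 3) (Or.inr (by norm_num))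
  rw [Real.zero_rpow (by norm_num)] at h'
  refine h'.congr fun τ => ?_
  rw [norm_pow, ← Real.rpow_natCast, ← Real.rpow_mul (norm_nonneg _)]
  norm_num

section Vanishing

variable {F H : ℂ → ℂ}

lemma fricke_symm (hS : ∀ τ : ℂ, 0 < τ.im → F (nome (-1 / τ)) = τ ^ 6 * H (nome (τ / 3)))
    {τ : ℂ} (hτ : 0 < τ.im) : H (nome (-1 / τ / 3)) = τ ^ 6 * F (nome τ) := by
  have h0 : τ ≠ 0 := by rintro rfl; simp at hτ
  have h := hS (-1 / τ) (im_neg_one_div_pos hτ)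
  rw [show -1 / (-1 / τ) = τ by field_simp] at h
  rw [h, div_pow, show (-1 : ℂ) ^ 6 = 1 by norm_num]
  field_simp

/-- With σ = -1/(τ - 1) - 1 = -τ/(τ - 1) one has -1/σ = -1/τ + 1. Applying the relation at σ,
dropping the integer translation, and applying it again at τ - 1 gives the factor (σ(τ - 1))⁶ = τ⁶.
-/
lemma fricke_translate (hS : ∀ τ : ℂ, 0 < τ.im → F (nome (-1 / τ)) = τ ^ 6 * H (nome (τ / 3)))
    {τ : ℂ} (hτ : 0 < τ.im) :
    H (nome ((-1 / τ + 1) / 3)) = τ ^ 6 * H (nome ((τ + 2) / 3)) := by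
  have h0 : τ ≠ 0 := by rintro rfl; simp at hτ
  have hτ1 : 0 < (τ - 1).im := by simpa using hτ
  have h1 : τ - 1 ≠ 0 := by intro h; rw [h] at hτ1; simp at hτ1
  have hσ : 0 < (-1 / (τ - 1) - 1).im := by simpa using im_neg_one_div_pos hτ1
  have e1 : -1 / (-1 / (τ - 1) - 1) = -1 / τ + 1 := by
    have : -1 / (τ - 1) - 1 = - τ / (τ - 1) := by field_simp; ring
    rw [this]; field_simp; ring
  have e2 : nome (-1 / (τ - 1) - 1) = nome (-1 / (τ - 1)) := by
    rw [← nome_add_one (-1 / (τ - 1) - 1), sub_add_cancel]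
  have e3 : nome ((τ - 1) / 3) = nome ((τ + 2) / 3) := by
    rw [← nome_add_one ((τ - 1) / 3)]; congr 1; ring
  have h := fricke_symm hS hσ
  rw [e1, e2, hS _ hτ1, e3, ← mul_assoc, ← mul_pow] at h
  rw [h, show (-1 / (τ - 1) - 1) * (τ - 1) = -τ by field_simp; ring, Even.neg_pow (by decide)]

lemma fricke_translate_two
    (hS : ∀ τ : ℂ, 0 < τ.im → F (nome (-1 / τ)) = τ ^ 6 * H (nome (τ / 3)))
    {τ : ℂ} (hτ : 0 < τ.im) :
    H (nome ((-1 / τ + 2) / 3)) = τ ^ 6 * H (nome ((τ + 1) / 3)) := by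
  have h0 : τ ≠ 0 := by rintro rfl; simp at hτ
  have h := fricke_translate hS (im_neg_one_div_pos hτ)
  rw [show -1 / (-1 / τ) = τ by field_simp] at h
  rw [h, div_pow, show (-1 : ℂ) ^ 6 = 1 by norm_num]
  field_simp

/-- If `F` and `H` are related by `τ ↦ -1 / τ` in weight `6` and vanish at `0` to orders at least
two and one, then `F` vanishes: the norm of `F(nome τ)` to level one has weight `24` and vanishes
at the cusp to order greater than two. -/
theorem eqOn_zero_of_fricke (hF : DifferentiableOn ℂ F (Metric.ball 0 1))
    (hH : DifferentiableOn ℂ H (Metric.ball 0 1)) (hF0 : F 0 = 0) (hF1 : HasDerivAt F 0 0)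
    (hH0 : H 0 = 0)
    (hS : ∀ τ : ℂ, 0 < τ.im → F (nome (-1 / τ)) = τ ^ 6 * H (nome (τ / 3))) :
    ∀ z ∈ Metric.ball (0 : ℂ) 1, F z = 0 := by
  set g : ℂ → ℂ := fun τ => H (nome (τ / 3)) with hg
  have hgdiff (j : ℂ) (hj : j.im = 0) :
      DifferentiableOn ℂ (fun τ => g (τ + j)) upperHalfPlaneSet := by
    refine (differentiableOn_comp_nome hH).comp (t := upperHalfPlaneSet)
      (f := fun τ => (τ + j) / 3) (by fun_prop) fun τ hτ => ?_
    exact im_div_three_pos (by simpa [hj] using hτ)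
  have hfdiff := differentiableOn_comp_nome hF
  have hg0 : DifferentiableOn ℂ g upperHalfPlaneSet := by simpa using hgdiff 0 rfl
  have hg1 := hgdiff 1 rfl
  have hg2 := hgdiff 2 (by simp)
  set N : ℂ → ℂ := fun τ => F (nome τ) * g τ * (g (τ + 1) * g (τ + 2)) with hN
  have hNdiff : DifferentiableOn ℂ N upperHalfPlaneSet := (hfdiff.mul hg0).mul (hg1.mul hg2)
  have hΔdiff : DifferentiableOn ℂ (fun τ => (eta τ ^ 24) ^ 2) upperHalfPlaneSet := fun τ hτ =>
    (((differentiableAt_eta_of_mem_upperHalfPlaneSet hτ).pow 24).pow 2).differentiableWithinAt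
  have key : ∀ τ : ℍ, N τ / (ModularForm.discriminant τ) ^ 2 = 0 := by
    refine eq_zero_of_invariant_of_tendsto_zero
      (mdifferentiable_of_differentiableOn (hNdiff.div hΔdiff fun τ hτ =>
        pow_ne_zero _ (pow_ne_zero _ (eta_ne_zero hτ)))) (fun τ => ?_) (fun τ => ?_) ?_
    · rw [discriminant_T_smul, coe_T_smul]
      congr 1
      simp only [hN, hg, nome_add_one]
      rw [show ((τ : ℂ) + 1 + 2) / 3 = τ / 3 + 1 by ring, nome_add_one,
        show (τ : ℂ) + 1 + 1 = τ + 2 by ring]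
      ring
    · rw [discriminant_S_smul, coe_S_smul]
      have h0 : (τ : ℂ) ≠ 0 := τ.ne_zero
      have hΔ := ModularForm.discriminant_ne_zero τ
      -- Inversion exchanges the first two factors of `N` and also its last two, each factor picking
      -- up τ⁶.
      have : N (-1 / (τ : ℂ)) = (τ : ℂ) ^ 24 * N τ := by
        simp only [hN, hg]
        rw [hS _ τ.2, fricke_symm hS τ.2, fricke_translate hS τ.2, fricke_translate_two hS τ.2]
        ring
      rw [this, mul_pow, ← pow_mul, mul_div_mul_left _ _ (pow_ne_zero _ h0)]
    · have hn := tendsto_nome_atImInfty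
      have hfo : (fun τ : ℍ => F (nome τ)) =o[atImInfty] fun τ : ℍ => nome τ := by
        have := hF1.isLittleO
        simp only [hF0, sub_zero, smul_zero] at this
        exact this.comp_tendsto hn
      have hgO (j : ℂ) (hj : j.im = 0) : (fun τ : ℍ => g (τ + j)) =O[atImInfty]
          fun τ : ℍ => nome (τ / 3) := by
        have hHO : H =O[𝓝 0] fun z => z := by
          have := (hH.differentiableAt (Metric.ball_mem_nhds 0 one_pos)).isBigO_sub
          simpa [hH0] using this
        have hlim : Tendsto (fun τ : ℍ => nome ((τ + j) / 3)) atImInfty (𝓝 0) := by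
          rw [tendsto_zero_iff_norm_tendsto_zero]
          simpa only [norm_nome_add_div_three _ hj, norm_zero] using tendsto_nome_div_three.norm
        refine (hHO.comp_tendsto hlim).trans (.of_bound 1 (.of_forall fun τ => ?_))
        simp [norm_nome_add_div_three _ hj]
      have hg0O := hgO 0 rfl
      simp only [add_zero] at hg0O
      have hNo := (hfo.mul_isBigO hg0O).mul_isBigO ((hgO 1 rfl).mul (hgO 2 (by simp)))
      -- The three conjugates of `H` are each O(nome^(1/3)) and together supply one full power of
      -- the nome; the factor `F`, being o(nome), makes the product o(nome²).
      have hpow : ∀ τ : ℍ, nome τ * nome (τ / 3) * (nome (τ / 3) * nome (τ / 3)) = nome τ ^ 2 :=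
        fun τ => by rw [sq, ← nome_div_three_pow_three τ]; ring
      simp only [hpow] at hNo
      replace hNo := hNo.trans_isBigO (nome_isBigO_discriminant.pow 2)
      exact hNo.tendsto_div_nhds_zero
  have hN0 : ∀ τ ∈ upperHalfPlaneSet, N τ = 0 := fun τ hτ => by
    have := key ⟨τ, hτ⟩
    rwa [div_eq_zero_iff, or_iff_left (pow_ne_zero _ (discriminant_ne_zero _))] at this
  have hopen := isOpen_upperHalfPlaneSet
  have hconn := isPreconnected_upperHalfPlaneSet
  have hfzero : ∀ τ ∈ upperHalfPlaneSet, F (nome τ) = 0 := by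
    -- By the identity theorem one factor of `N` vanishes identically; if it is a conjugate of `H`,
    -- the inversion relation carries the vanishing back to `F`.
    have hgz : (∀ τ ∈ upperHalfPlaneSet, g τ = 0) →
        ∀ τ ∈ upperHalfPlaneSet, F (nome τ) = 0 := fun h τ hτ => by
      have h0 : τ ≠ 0 := by rintro rfl; simp at hτ
      have h1 := hS (-1 / τ) (im_neg_one_div_pos hτ)
      rw [show -1 / (-1 / τ) = τ by field_simp] at h1
      rw [h1, show H (nome (-1 / τ / 3)) = 0 from h _ (im_neg_one_div_pos hτ), mul_zero]
    have hgj (j : ℂ) (hj : j.im = 0) (h : ∀ τ ∈ upperHalfPlaneSet, g (τ + j) = 0) :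
        ∀ τ ∈ upperHalfPlaneSet, g τ = 0 := fun τ hτ => by
      have := h (τ - j) (by simpa [hj] using hτ)
      rwa [sub_add_cancel] at this
    rcases AnalyticOnNhd.eq_zero_or_eq_zero_of_mul_eq_zero ((hfdiff.mul hg0).analyticOnNhd hopen)
      ((hg1.mul hg2).analyticOnNhd hopen) hN0 hconn with h | h
    · rcases AnalyticOnNhd.eq_zero_or_eq_zero_of_mul_eq_zero (hfdiff.analyticOnNhd hopen)
        (hg0.analyticOnNhd hopen) h hconn with h | h
      · exact h
      · exact hgz h
    · rcases AnalyticOnNhd.eq_zero_or_eq_zero_of_mul_eq_zero (hg1.analyticOnNhd hopen)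
        (hg2.analyticOnNhd hopen) h hconn with h | h
      · exact hgz (hgj 1 rfl h)
      · exact hgz (hgj 2 (by simp) h)
  intro z hz
  rcases eq_or_ne z 0 with rfl | h0
  · exact hF0
  · obtain ⟨τ, hτ, rfl⟩ := exists_nome_eq hz h0
    exact hfzero τ hτ

end Vanishing

/-! ### Derivatives and polynomial relations -/

lemma hasDerivAt_of_differentiableOn_ball {F : ℂ → ℂ}
    (hF : DifferentiableOn ℂ F (Metric.ball 0 1)) {z : ℂ} (hz : z ∈ Metric.ball (0 : ℂ) 1) :
    HasDerivAt F (deriv F z) z :=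
  (hF.differentiableAt (Metric.isOpen_ball.mem_nhds hz)).hasDerivAt

lemma hasDerivAt_comp_nome {F : ℂ → ℂ} (hF : DifferentiableOn ℂ F (Metric.ball 0 1)) {τ : ℂ}
    (hτ : 0 < τ.im) :
    HasDerivAt (fun τ => F (nome τ)) (2 * Real.pi * I * (nome τ * deriv F (nome τ))) τ := by
  have h := HasDerivAt.comp τ (hasDerivAt_of_differentiableOn_ball hF (nome_mem_ball hτ))
    (hasDerivAt_nome τ)
  convert! h using 1
  ring

lemma hasDerivAt_eta {τ : ℂ} (hτ : 0 < τ.im) :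
    HasDerivAt eta (Real.pi * I / 12 * discE2 (nome τ) * eta τ) τ := by
  have h := (differentiableAt_eta_of_mem_upperHalfPlaneSet hτ).hasDerivAt
  have h2 := logDeriv_eta_eq_E2 ⟨τ, hτ⟩
  rw [← discE2_nome, logDeriv_apply, div_eq_iff (eta_ne_zero hτ)] at h2
  convert! h using 1
  exact h2.symm

lemma im_three_mul_pos {τ : ℂ} (hτ : 0 < τ.im) : 0 < (3 * τ).im := by
  simpa using hτ

lemma hasDerivAt_eta_three_mul {τ : ℂ} (hτ : 0 < τ.im) :
    HasDerivAt (fun τ => eta (3 * τ))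
      (Real.pi * I / 4 * discE2 (nome τ ^ 3) * eta (3 * τ)) τ := by
  have h := HasDerivAt.comp τ (hasDerivAt_eta (im_three_mul_pos hτ))
    ((hasDerivAt_id τ).const_mul (3 : ℂ))
  convert! h using 1
  rw [nome_three_mul]
  ring

/-- Since z d/dz log η = E₂/24, the logarithmic derivative is (3/8)(E₂(z) - E₂(z³)), which equals (B
- P)/2. -/
lemma mul_deriv_discC {z : ℂ} (hz : z ∈ Metric.ball (0 : ℂ) 1) :
    z * deriv discC z = discC z * (discB z - discP z) / 2 := by
  rcases eq_or_ne z 0 with rfl | h0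
  · simp [discB_zero, discP_zero]
  obtain ⟨τ, hτ, rfl⟩ := exists_nome_eq hz h0
  have hη : eta τ ≠ 0 := eta_ne_zero hτ
  have hη3 : eta (3 * τ) ≠ 0 := eta_ne_zero (im_three_mul_pos hτ)
  have h1 := hasDerivAt_comp_nome differentiableOn_discC hτ
  have h2 := ((hasDerivAt_eta hτ).pow 9).div ((hasDerivAt_eta_three_mul hτ).pow 3)
    (pow_ne_zero _ hη3)
  have h3 : (fun τ => discC (nome τ)) = (eta ^ 9) / ((fun τ => eta (3 * τ)) ^ 3) := by
    ext τ; simp [discC_nome]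
  rw [h3] at h1
  have h4 := h1.unique h2
  apply mul_left_cancel₀ Complex.two_pi_I_ne_zero
  rw [h4, discC_nome, discB, discP]
  simp only [Pi.pow_apply]
  field_simp
  ring

lemma mul_deriv_discD {z : ℂ} (hz : z ∈ Metric.ball (0 : ℂ) 1) :
    z * deriv discD z = discD z * (discB z + discP z) / 2 := by
  rcases eq_or_ne z 0 with rfl | h0
  · simp [discD_zero]
  obtain ⟨τ, hτ, rfl⟩ := exists_nome_eq hz h0
  have hη : eta τ ≠ 0 := eta_ne_zero hτ
  have hη3 : eta (3 * τ) ≠ 0 := eta_ne_zero (im_three_mul_pos hτ)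
  have h1 := hasDerivAt_comp_nome differentiableOn_discD hτ
  have h2 := ((hasDerivAt_eta_three_mul hτ).pow 9).div ((hasDerivAt_eta hτ).pow 3)
    (pow_ne_zero _ hη)
  have h3 : (fun τ => discD (nome τ)) = ((fun τ => eta (3 * τ)) ^ 9) / (eta ^ 3) := by
    ext τ; simp [discD_nome]
  rw [h3] at h1
  have h4 := h1.unique h2
  apply mul_left_cancel₀ Complex.two_pi_I_ne_zero
  rw [h4, discD_nome, discB, discP]
  simp only [Pi.pow_apply]
  field_simp
  ring

/-! ### First-order expansions of C, D and G at the cusp. -/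

lemma zero_mem_unit_ball : (0 : ℂ) ∈ Metric.ball (0 : ℂ) 1 := Metric.mem_ball_self one_pos

lemma hasDerivAt_id_mul_zero {F : ℂ → ℂ} (hF : DifferentiableOn ℂ F (Metric.ball 0 1)) :
    HasDerivAt (fun z => z * F z) (F 0) 0 := by
  convert! (hasDerivAt_id (0 : ℂ)).mul
    (hasDerivAt_of_differentiableOn_ball hF zero_mem_unit_ball) using 1
  simp

lemma differentiableOn_deriv_ball {F : ℂ → ℂ} (hF : DifferentiableOn ℂ F (Metric.ball 0 1)) :
    DifferentiableOn ℂ (deriv F) (Metric.ball 0 1) :=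
  hF.deriv Metric.isOpen_ball

lemma hasDerivAt_discC_zero : HasDerivAt discC (-9) 0 := by
  have h := hasDerivAt_of_differentiableOn_ball differentiableOn_discC zero_mem_unit_ball
  have h1 := hasDerivAt_id_mul_zero (differentiableOn_deriv_ball differentiableOn_discC)
  have h2 := (h.mul (hasDerivAt_discB_zero.sub hasDerivAt_discP_zero)).div_const 2
  have h3 := h2.congr_of_eventuallyEq (f₁ := fun z => z * deriv discC z) <| by
    filter_upwards [Metric.ball_mem_nhds (0 : ℂ) one_pos] with z hz
    exact mul_deriv_discC hz
  -- The relation z C' = C(B - P)/2 is trivial at 0; its linear terms give C'(0) = (-6 - 12)/2.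
  have h4 := h1.unique h3
  norm_num [discB_zero, discP_zero, discC_zero] at h4
  rwa [h4] at h

lemma hasDerivAt_discD_zero : HasDerivAt discD 1 0 := by
  have h : DifferentiableOn ℂ (fun z => eulerProd (z ^ 3) ^ 9 / eulerProd z ^ 3)
      (Metric.ball 0 1) :=
    ((differentiableOn_comp_pow_three differentiableOn_eulerProd).pow 9).div
      (differentiableOn_eulerProd.pow 3) fun _ hz => pow_ne_zero _ (eulerProd_ne_zero hz)
  have h1 := hasDerivAt_id_mul_zero h
  convert! h1 using 1
  · ext z; rw [discD, mul_div_assoc]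
  · simp [eulerProd_zero]

lemma hasDerivAt_discG_zero : HasDerivAt discG 18 0 := by
  convert! hasDerivAt_discC_zero.add (hasDerivAt_discD_zero.const_mul 27) using 1
  norm_num

/-! ### Weight-six identities obtained from the vanishing criterion. -/

lemma discP_pow_three {z : ℂ} (hz : z ∈ Metric.ball (0 : ℂ) 1) : discP z ^ 3 = discG z ^ 2 := by
  have hdiff : DifferentiableOn ℂ (fun z => discP z ^ 3 - discG z ^ 2) (Metric.ball 0 1) :=
    (differentiableOn_discP.pow 3).sub (differentiableOn_discG.pow 2)
  -- P³ and G² acquire the same factor -τ⁶/27 under inversion, and both begin 1 + 36z.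
  refine sub_eq_zero.mp (eqOn_zero_of_fricke (F := fun z => discP z ^ 3 - discG z ^ 2)
    (H := fun z => -(1 / 27) * (discP z ^ 3 - discG z ^ 2)) hdiff (hdiff.const_mul _)
    ?_ ?_ ?_ ?_ z hz)
  · simp [discP_zero, discG_zero]
  · convert! (hasDerivAt_discP_zero.pow 3).sub (hasDerivAt_discG_zero.pow 2) using 1
    norm_num [discP_zero, discG_zero]
  · simp [discP_zero, discG_zero]
  · intro τ hτ
    have hr := sqrt_three_sq
    rw [discP_nome_neg_one_div hτ, discG_nome_neg_one_div hτ]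
    simp only [div_pow, mul_pow, hr, I_sq]
    ring

/-- This is the weight-four formula 9E₄(3τ) = A⁴ + 8AC multiplied by A² = P: the product has weight
6 and involves A only through P and G, so it makes sense before A is constructed. Inversion
exchanges E₄(3τ) with E₄(τ) and C with D, up to constants, which dictates `H`. -/
lemma discE4_mul_discP_relation : ∀ z ∈ Metric.ball (0 : ℂ) 1,
    9 * discE4 (z ^ 3) * discP z - discP z ^ 3 - 8 * (discG z * discC z) = 0 := by
  refine eqOn_zero_of_fricke
    (H := fun z => -(1 / 27) * (discE4 z * discP z - discP z ^ 3 - 216 * (discG z * discD z)))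
    ?_ ?_ ?_ ?_ ?_ ?_
  · exact ((((differentiableOn_comp_pow_three differentiableOn_discE4).const_mul 9).mul
      differentiableOn_discP).sub (differentiableOn_discP.pow 3)).sub
      ((differentiableOn_discG.mul differentiableOn_discC).const_mul 8)
  · exact (((differentiableOn_discE4.mul differentiableOn_discP).sub
      (differentiableOn_discP.pow 3)).sub
      ((differentiableOn_discG.mul differentiableOn_discD).const_mul 216)).const_mul _
  · norm_num [discP_zero, discG_zero, discC_zero, discE4_zero]
  · have hE := hasDerivAt_comp_pow_three_zero
      (hasDerivAt_of_differentiableOn_ball differentiableOn_discE4 zero_mem_unit_ball)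
    convert! (((hE.const_mul 9).mul hasDerivAt_discP_zero).sub (hasDerivAt_discP_zero.pow 3)).sub
      ((hasDerivAt_discG_zero.mul hasDerivAt_discC_zero).const_mul 8) using 1
    norm_num [discP_zero, discG_zero, discC_zero, discE4_zero]
  · norm_num [discP_zero, discD_zero, discE4_zero]
  · intro τ hτ
    have hr := sqrt_three_ne_zero
    rw [nome_neg_one_div_pow_three, discE4_nome_neg_one_div (im_div_three_pos hτ),
      discP_nome_neg_one_div hτ, discG_nome_neg_one_div hτ, discC_nome_neg_one_div hτ]
    field_simp
    ring_nf
    simp only [I_sq]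
    ring

lemma discE6_relation : ∀ z ∈ Metric.ball (0 : ℂ) 1,
    27 * discE6 (z ^ 3) + discP z ^ 3 - 20 * (discG z * discC z) - 8 * discC z ^ 2 = 0 := by
  refine eqOn_zero_of_fricke
    (H := fun z => 1 / 27 * discE6 z - 1 / 27 * discP z ^ 3 + 20 * (discG z * discD z)
      + 216 * discD z ^ 2) ?_ ?_ ?_ ?_ ?_ ?_
  · exact ((((differentiableOn_comp_pow_three differentiableOn_discE6).const_mul 27).add
      (differentiableOn_discP.pow 3)).sub
      ((differentiableOn_discG.mul differentiableOn_discC).const_mul 20)).sub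
      ((differentiableOn_discC.pow 2).const_mul 8)
  · exact (((differentiableOn_discE6.const_mul _).sub
      ((differentiableOn_discP.pow 3).const_mul _)).add
      ((differentiableOn_discG.mul differentiableOn_discD).const_mul 20)).add
      ((differentiableOn_discD.pow 2).const_mul 216)
  · norm_num [discP_zero, discG_zero, discC_zero, discE6_zero]
  · have hE := hasDerivAt_comp_pow_three_zero
      (hasDerivAt_of_differentiableOn_ball differentiableOn_discE6 zero_mem_unit_ball)
    convert! (((hE.const_mul 27).add (hasDerivAt_discP_zero.pow 3)).sub
      ((hasDerivAt_discG_zero.mul hasDerivAt_discC_zero).const_mul 20)).sub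
      ((hasDerivAt_discC_zero.pow 2).const_mul 8) using 1
    norm_num [discP_zero, discG_zero, discC_zero, discE6_zero]
  · norm_num [discP_zero, discD_zero, discE6_zero]
  · intro τ hτ
    have hr := sqrt_three_ne_zero
    have hr2 := sqrt_three_sq
    rw [nome_neg_one_div_pow_three, discE6_nome_neg_one_div (im_div_three_pos hτ),
      discP_nome_neg_one_div hτ, discG_nome_neg_one_div hτ, discC_nome_neg_one_div hτ]
    simp only [mul_pow, hr2, I_sq]
    field_simp
    ring_nf
    simp only [I_sq]
    ring

/-- Obtained by differentiating the transformation law of B in τ; the two lower-order terms come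
from the factor τ² and from the anomaly 3τ/(πi). -/
lemma mul_deriv_discB_nome_neg_one_div {τ : ℂ} (hτ : 0 < τ.im) :
    nome (-1 / τ) * deriv discB (nome (-1 / τ)) =
      τ ^ 4 * (nome (τ / 3) * deriv discB (nome (τ / 3))) / 9 +
      τ ^ 3 * discB (nome (τ / 3)) / (3 * Real.pi * I) - 3 * τ ^ 2 / (2 * Real.pi ^ 2) := by
  have h0 : τ ≠ 0 := by rintro rfl; simp at hτ
  have hpi : (Real.pi : ℂ) ≠ 0 := by exact_mod_cast Real.pi_ne_zero
  have hinv : HasDerivAt (fun τ : ℂ => -1 / τ) (1 / τ ^ 2) τ := by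
    convert! ((hasDerivAt_inv h0).neg) using 1
    · ext x; simp [neg_div]
    · field_simp
  have h1 := HasDerivAt.comp τ (hasDerivAt_comp_nome differentiableOn_discB
    (im_neg_one_div_pos hτ)) hinv
  have h2 := HasDerivAt.comp τ (hasDerivAt_comp_nome differentiableOn_discB
    (im_div_three_pos hτ)) ((hasDerivAt_id τ).div_const 3)
  have h3 := ((((hasDerivAt_pow 2 τ).mul h2).div_const 3).add
    (((hasDerivAt_id τ).const_mul 3).div_const (Real.pi * I)))
  have h4 := h1.unique (h3.congr_of_eventuallyEq (by
    filter_upwards [isOpen_upperHalfPlaneSet.mem_nhds hτ] with σ hσ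
    simpa using discB_nome_neg_one_div hσ))
  have hI := I_sq
  simp only [Function.comp_apply, id] at h4
  field_simp at h4 ⊢
  linear_combination (-3 * I) * h4 +
    (54 * Real.pi ^ 2 * I * nome (-(1 / τ)) * deriv discB (nome (-(1 / τ))) -
      6 * Real.pi ^ 2 * I * τ ^ 4 * nome (τ / 3) * deriv discB (nome (τ / 3)) -
      18 * Real.pi * τ ^ 3 * discB (nome (τ / 3))) * hI

/-- A Ramanujan-type equation. The non-modular terms of 6zB' and of B² under inversion coincide, so
6zB' - B² is modular of weight 4; the factor P raises the weight to 6. -/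
lemma mul_deriv_discB_mul_discP_relation : ∀ z ∈ Metric.ball (0 : ℂ) 1,
    6 * (z * deriv discB z) * discP z - discB z ^ 2 * discP z + discP z ^ 3 = 0 := by
  have hd : DifferentiableOn ℂ (fun z => z * deriv discB z) (Metric.ball 0 1) :=
    differentiableOn_id.mul (differentiableOn_deriv_ball differentiableOn_discB)
  have hdiff : DifferentiableOn ℂ (fun z => 6 * (z * deriv discB z) * discP z -
      discB z ^ 2 * discP z + discP z ^ 3) (Metric.ball 0 1) :=
    (((hd.const_mul 6).mul differentiableOn_discP).sub
      ((differentiableOn_discB.pow 2).mul differentiableOn_discP)).add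
      (differentiableOn_discP.pow 3)
  refine eqOn_zero_of_fricke (H := fun z => -(1 / 27) * (6 * (z * deriv discB z) * discP z -
      discB z ^ 2 * discP z + discP z ^ 3)) hdiff (hdiff.const_mul _) ?_ ?_ ?_ ?_
  · simp [discP_zero, discB_zero]
  · have h1 := hasDerivAt_id_mul_zero (differentiableOn_deriv_ball differentiableOn_discB)
    rw [hasDerivAt_discB_zero.deriv] at h1
    convert! (((h1.const_mul 6).mul hasDerivAt_discP_zero).sub
      ((hasDerivAt_discB_zero.pow 2).mul hasDerivAt_discP_zero)).add
      (hasDerivAt_discP_zero.pow 3) using 1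
    norm_num [discP_zero, discB_zero]
  · simp [discP_zero, discB_zero]
  · intro τ hτ
    have hpi : (Real.pi : ℂ) ≠ 0 := by exact_mod_cast Real.pi_ne_zero
    rw [mul_deriv_discB_nome_neg_one_div hτ, discP_nome_neg_one_div hτ, discB_nome_neg_one_div hτ]
    field_simp
    ring_nf
    simp only [I_sq]
    ring

/-! ### The cube root `A` as a function of the nome -/

/-- The cube root of `discG`. At a zero of `discP` the convention `x / 0 = 0` yields the value of
the holomorphic extension. -/
def discA (z : ℂ) : ℂ := discG z / discP z

lemma discG_eq_zero_of_discP {z : ℂ} (hz : z ∈ Metric.ball (0 : ℂ) 1) (h : discP z = 0) :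
    discG z = 0 := by
  have := discP_pow_three hz
  rw [h] at this
  simpa using this.symm

lemma discA_pow_three {z : ℂ} (hz : z ∈ Metric.ball (0 : ℂ) 1) : discA z ^ 3 = discG z := by
  by_cases h : discP z = 0
  · simp [discA, h, discG_eq_zero_of_discP hz h]
  · rw [discA, div_pow, discP_pow_three hz]
    have : discG z ≠ 0 := by
      intro h0
      have := discP_pow_three hz
      rw [h0] at this
      exact h (by simpa using this)
    field_simp

lemma discA_sq {z : ℂ} (hz : z ∈ Metric.ball (0 : ℂ) 1) : discA z ^ 2 = discP z := by
  by_cases h : discP z = 0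
  · simp [discA, h]
  · rw [discA, div_pow, ← discP_pow_three hz]
    field_simp

lemma discA_mul_discP {z : ℂ} (hz : z ∈ Metric.ball (0 : ℂ) 1) : discA z * discP z = discG z := by
  rw [← discA_sq hz, ← discA_pow_three hz]; ring

lemma discA_zero : discA 0 = 1 := by simp [discA, discG_zero, discP_zero]

lemma isPreconnected_unit_ball : IsPreconnected (Metric.ball (0 : ℂ) 1) :=
  (convex_ball _ _).isPreconnected

lemma eventually_discP_ne_zero {z : ℂ} (hz : z ∈ Metric.ball (0 : ℂ) 1) :
    ∀ᶠ w in 𝓝[≠] z, discP w ≠ 0 := by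
  have han := differentiableOn_discP.analyticOnNhd Metric.isOpen_ball
  rcases (han z hz).eventually_eq_zero_or_eventually_ne_zero with h | h
  · have := han.eqOn_zero_of_preconnected_of_eventuallyEq_zero isPreconnected_unit_ball hz h
      zero_mem_unit_ball
    simp [discP_zero] at this
  · exact h

lemma differentiableOn_discA : DifferentiableOn ℂ discA (Metric.ball 0 1) := by
  have hball := Metric.isOpen_ball (x := (0 : ℂ)) (ε := 1)
  have hreg : ∀ w ∈ Metric.ball (0 : ℂ) 1, discP w ≠ 0 → DifferentiableAt ℂ discA w :=
    fun w hw h => (differentiableOn_discG.differentiableAt (hball.mem_nhds hw)).div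
      (differentiableOn_discP.differentiableAt (hball.mem_nhds hw)) h
  intro z hz
  refine DifferentiableAt.differentiableWithinAt ?_
  by_cases h : discP z = 0
  · refine (Complex.analyticAt_of_differentiable_on_punctured_nhds_of_continuousAt ?_
      ?_).differentiableAt
    · filter_upwards [eventually_discP_ne_zero hz, nhdsWithin_le_nhds (hball.mem_nhds hz)]
        with w hw hwb using hreg w hwb hw
    · have hAz : discA z = 0 := by simp [discA, h]
      rw [ContinuousAt, hAz, tendsto_zero_iff_norm_tendsto_zero]
      -- At a zero of P the singularity is removable: |A|³ = |G| tends to 0, which is also the value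
      -- of A there under division by zero.
      have hG : Tendsto (fun w => ‖discG w‖) (𝓝 z) (𝓝 0) := by
        have := (differentiableOn_discG.differentiableAt (hball.mem_nhds hz)).continuousAt.norm
        rwa [ContinuousAt, discG_eq_zero_of_discP hz h, norm_zero] at this
      have h' := hG.rpow_const (p := 1 / 3) (Or.inr (by norm_num))
      rw [Real.zero_rpow (by norm_num)] at h'
      refine h'.congr' ?_
      filter_upwards [hball.mem_nhds hz] with w hw
      rw [← discA_pow_three hw, norm_pow, ← Real.rpow_natCast, ← Real.rpow_mul (norm_nonneg _)]
      norm_num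
  · exact hreg z hz h

/-- P equals 1 at the cusp, hence can be cancelled; this brings the auxiliary weight-six identities
back to weight 4. -/
lemma eqOn_ball_of_mul_discP {F : ℂ → ℂ} (hF : DifferentiableOn ℂ F (Metric.ball 0 1))
    (h : ∀ z ∈ Metric.ball (0 : ℂ) 1, F z * discP z = 0) :
    ∀ z ∈ Metric.ball (0 : ℂ) 1, F z = 0 := by
  rcases AnalyticOnNhd.eq_zero_or_eq_zero_of_mul_eq_zero (hF.analyticOnNhd Metric.isOpen_ball)
    (differentiableOn_discP.analyticOnNhd Metric.isOpen_ball) h isPreconnected_unit_ball with h | h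
  · exact h
  · have := h 0 zero_mem_unit_ball
    simp [discP_zero] at this

lemma three_mul_discE2 {z : ℂ} (hz : z ∈ Metric.ball (0 : ℂ) 1) :
    3 * discE2 (z ^ 3) = 2 * discB z + discA z ^ 2 := by
  rw [discA_sq hz, discB, discP]; ring

lemma nine_mul_discE4 {z : ℂ} (hz : z ∈ Metric.ball (0 : ℂ) 1) :
    9 * discE4 (z ^ 3) = discA z ^ 4 + 8 * discA z * discC z := by
  refine sub_eq_zero.mp (eqOn_ball_of_mul_discP
    (F := fun z => 9 * discE4 (z ^ 3) - (discA z ^ 4 + 8 * discA z * discC z)) ?_ ?_ z hz)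
  · exact ((differentiableOn_comp_pow_three differentiableOn_discE4).const_mul 9).sub
      ((differentiableOn_discA.pow 4).add
        ((differentiableOn_discA.const_mul 8).mul differentiableOn_discC))
  · intro z hz
    have h1 := discE4_mul_discP_relation z hz
    rw [← discA_mul_discP hz] at h1
    have h2 := discA_sq hz
    linear_combination h1 - (discA z ^ 2 + discP z) * discP z * h2

lemma twentySeven_mul_discE6 {z : ℂ} (hz : z ∈ Metric.ball (0 : ℂ) 1) :
    27 * discE6 (z ^ 3) = -discA z ^ 6 + 20 * discA z ^ 3 * discC z + 8 * discC z ^ 2 := by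
  have h1 := discE6_relation z hz
  rw [← discA_pow_three hz, ← discA_sq hz] at h1
  linear_combination h1

lemma mul_deriv_discB {z : ℂ} (hz : z ∈ Metric.ball (0 : ℂ) 1) :
    z * deriv discB z = (discB z ^ 2 - discA z ^ 4) / 6 := by
  refine sub_eq_zero.mp (eqOn_ball_of_mul_discP
    (F := fun z => z * deriv discB z - (discB z ^ 2 - discA z ^ 4) / 6) ?_ ?_ z hz)
  · exact (differentiableOn_id.mul (differentiableOn_deriv_ball differentiableOn_discB)).sub
      (((differentiableOn_discB.pow 2).sub (differentiableOn_discA.pow 4)).div_const 6)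
  · intro z hz
    have h1 := mul_deriv_discB_mul_discP_relation z hz
    have h2 := discA_sq hz
    linear_combination h1 / 6 + (discA z ^ 2 + discP z) * discP z * h2 / 6

/-! ### Logarithmic derivatives -/

/-- `f` has derivative `v` at `z` with respect to the vector field `z d/dz`. -/
def HasEulerDerivAt (f : ℂ → ℂ) (v z : ℂ) : Prop := ∃ f' : ℂ, HasDerivAt f f' z ∧ z * f' = v

namespace HasEulerDerivAt

variable {f g : ℂ → ℂ} {v w z : ℂ}

lemma congr (hf : HasEulerDerivAt f v z) (h : v = w) : HasEulerDerivAt f w z := h ▸ hf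

lemma congr_fun (hf : HasEulerDerivAt f v z) (h : g =ᶠ[𝓝 z] f) : HasEulerDerivAt g v z := by
  obtain ⟨f', h1, h2⟩ := hf
  exact ⟨f', h1.congr_of_eventuallyEq h, h2⟩

lemma add (hf : HasEulerDerivAt f v z) (hg : HasEulerDerivAt g w z) :
    HasEulerDerivAt (fun z => f z + g z) (v + w) z := by
  obtain ⟨f', h1, h2⟩ := hf
  obtain ⟨g', h3, h4⟩ := hg
  exact ⟨f' + g', h1.add h3, by rw [mul_add, h2, h4]⟩

lemma const_mul (c : ℂ) (hf : HasEulerDerivAt f v z) :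
    HasEulerDerivAt (fun z => c * f z) (c * v) z := by
  obtain ⟨f', h1, h2⟩ := hf
  exact ⟨c * f', h1.const_mul c, by rw [← h2]; ring⟩

lemma sub_const (c : ℂ) (hf : HasEulerDerivAt f v z) :
    HasEulerDerivAt (fun z => f z - c) v z := by
  obtain ⟨f', h1, h2⟩ := hf
  exact ⟨f', h1.sub_const c, h2⟩

lemma sub (hf : HasEulerDerivAt f v z) (hg : HasEulerDerivAt g w z) :
    HasEulerDerivAt (fun z => f z - g z) (v - w) z := by
  obtain ⟨f', h1, h2⟩ := hf
  obtain ⟨g', h3, h4⟩ := hg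
  exact ⟨f' - g', h1.sub h3, by rw [mul_sub, h2, h4]⟩

lemma mul (hf : HasEulerDerivAt f v z) (hg : HasEulerDerivAt g w z) :
    HasEulerDerivAt (fun z => f z * g z) (v * g z + f z * w) z := by
  obtain ⟨f', h1, h2⟩ := hf
  obtain ⟨g', h3, h4⟩ := hg
  exact ⟨f' * g z + f z * g', h1.mul h3, by rw [← h2, ← h4]; ring⟩

lemma div (hf : HasEulerDerivAt f v z) (hg : HasEulerDerivAt g w z) (h : g z ≠ 0) :
    HasEulerDerivAt (fun z => f z / g z) ((v * g z - f z * w) / g z ^ 2) z := by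
  obtain ⟨f', h1, h2⟩ := hf
  obtain ⟨g', h3, h4⟩ := hg
  exact ⟨(f' * g z - f z * g') / g z ^ 2, h1.div h3 h, by rw [← h2, ← h4]; ring⟩

lemma pow (n : ℕ) (hf : HasEulerDerivAt f v z) :
    HasEulerDerivAt (fun z => f z ^ n) (n * f z ^ (n - 1) * v) z := by
  obtain ⟨f', h1, h2⟩ := hf
  exact ⟨n * f z ^ (n - 1) * f', h1.pow n, by rw [← h2]; ring⟩

/-- Stating the Euler derivative of `g` as a multiple of `g z` gives z d/dz = w · (q d/dq) with no
division, so the rule also holds where `g` vanishes. -/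
lemma comp (hf : HasEulerDerivAt f v (g z)) (hg : HasEulerDerivAt g (g z * w) z) :
    HasEulerDerivAt (fun z => f (g z)) (v * w) z := by
  obtain ⟨f', h1, h2⟩ := hf
  obtain ⟨g', h3, h4⟩ := hg
  exact ⟨f' * g', h1.comp z h3, by rw [← h2, mul_left_comm, h4]; ring⟩

lemma unique (hf : HasEulerDerivAt f v z) (hg : HasEulerDerivAt f w z) : v = w := by
  obtain ⟨f', h1, h2⟩ := hf
  obtain ⟨g', h3, h4⟩ := hg
  rw [← h2, ← h4, h1.unique h3]

lemma differentiableAt (hf : HasEulerDerivAt f v z) : DifferentiableAt ℂ f z := by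
  obtain ⟨f', h1, _⟩ := hf
  exact h1.differentiableAt

lemma mul_deriv (hf : HasEulerDerivAt f v z) : z * deriv f z = v := by
  obtain ⟨f', h1, h2⟩ := hf
  rw [h1.deriv, h2]

end HasEulerDerivAt

lemma hasEulerDerivAt_of_ball {F : ℂ → ℂ} {v z : ℂ}
    (hF : DifferentiableOn ℂ F (Metric.ball 0 1)) (hz : z ∈ Metric.ball (0 : ℂ) 1)
    (h : z * deriv F z = v) : HasEulerDerivAt F v z :=
  ⟨_, hasDerivAt_of_differentiableOn_ball hF hz, h⟩

lemma eq_of_hasEulerDerivAt_zero {f : ℂ → ℂ} {ε : ℝ} (hε : 0 < ε)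
    (h : ∀ z ∈ Metric.ball (0 : ℂ) ε, HasEulerDerivAt f 0 z) :
    ∀ z ∈ Metric.ball (0 : ℂ) ε, f z = f 0 := by
  have hdiff : DifferentiableOn ℂ f (Metric.ball 0 ε) := fun z hz =>
    (h z hz).differentiableAt.differentiableWithinAt
  have hd : ∀ z ∈ Metric.ball (0 : ℂ) ε, z ≠ 0 → deriv f z = 0 := fun z hz h0 =>
    (mul_eq_zero.mp (h z hz).mul_deriv).resolve_left h0
  -- The condition z f' = 0 says nothing at the origin; continuity of f' supplies it.
  have hd0 : deriv f 0 = 0 := by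
    have hc : ContinuousAt (deriv f) 0 :=
      ((hdiff.deriv Metric.isOpen_ball).differentiableAt (Metric.ball_mem_nhds 0 hε)).continuousAt
    refine tendsto_nhds_unique (hc.tendsto.mono_left (nhdsWithin_le_nhds (s := {0}ᶜ))) ?_
    refine tendsto_const_nhds.congr' ?_
    filter_upwards [self_mem_nhdsWithin, nhdsWithin_le_nhds (Metric.ball_mem_nhds 0 hε)]
      with z hz hzb using (hd z hzb hz).symm
  intro z hz
  refine Metric.isOpen_ball.is_const_of_deriv_eq_zero (convex_ball _ _).isPreconnected hdiff
    (fun w hw => ?_) hz (Metric.mem_ball_self hε)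
  rcases eq_or_ne w 0 with rfl | h0
  · exact hd0
  · exact hd w hw h0

lemma hasEulerDerivAt_discC {z : ℂ} (hz : z ∈ Metric.ball (0 : ℂ) 1) :
    HasEulerDerivAt discC (discC z * (discB z - discA z ^ 2) / 2) z :=
  hasEulerDerivAt_of_ball differentiableOn_discC hz (by rw [mul_deriv_discC hz, discA_sq hz])

lemma hasEulerDerivAt_discB {z : ℂ} (hz : z ∈ Metric.ball (0 : ℂ) 1) :
    HasEulerDerivAt discB ((discB z ^ 2 - discA z ^ 4) / 6) z :=
  hasEulerDerivAt_of_ball differentiableOn_discB hz (mul_deriv_discB hz)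

/-- Differentiate A³ = C + 27D, eliminate 27D = A³ - C, and cancel 3A². -/
lemma hasEulerDerivAt_discA {z : ℂ} (hz : z ∈ Metric.ball (0 : ℂ) 1) (hA : discA z ≠ 0) :
    HasEulerDerivAt discA (discA z * discB z / 6 + discA z ^ 3 / 6 - discC z / 3) z := by
  refine hasEulerDerivAt_of_ball differentiableOn_discA hz ?_
  have h1 := (hasEulerDerivAt_of_ball differentiableOn_discA hz rfl).pow 3
  have h2 := (hasEulerDerivAt_discC hz).add
    ((hasEulerDerivAt_of_ball differentiableOn_discD hz (mul_deriv_discD hz)).const_mul 27)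
  have h3 := (h2.congr_fun (g := fun z => discA z ^ 3) (by
    filter_upwards [Metric.isOpen_ball.mem_nhds hz] with w hw using discA_pow_three hw)).unique h1
  have h4 := discA_pow_three hz
  rw [discG] at h4
  rw [← discA_sq hz] at h3
  norm_num at h3
  apply mul_left_cancel₀ (pow_ne_zero 2 hA)
  linear_combination -h3 / 3 - (discB z + discA z ^ 2) / 6 * h4

/-! ### The hypergeometric series -/

/-- The sum of the power series with coefficients `b`. -/
def pser (b : ℕ → ℂ) (x : ℂ) : ℂ := ∑' n, b n * x ^ n

lemma norm_term_le {b : ℕ → ℂ} {M r : ℝ} (hb : ∀ n, ‖b n‖ ≤ M ^ n) {x : ℂ}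
    (hx : x ∈ Metric.ball (0 : ℂ) r) (n : ℕ) : ‖b n * x ^ n‖ ≤ (M * r) ^ n := by
  rw [norm_mul, norm_pow, mul_pow]
  have hx' : ‖x‖ ≤ r := by simpa using (Metric.mem_ball.mp hx).le
  exact mul_le_mul (hb n) (pow_le_pow_left₀ (norm_nonneg _) hx' n) (by positivity)
    ((norm_nonneg _).trans (hb n))

lemma summable_pser {b : ℕ → ℂ} {M r : ℝ} (hM : 0 ≤ M) (hr : 0 ≤ r) (hMr : M * r < 1)
    (hb : ∀ n, ‖b n‖ ≤ M ^ n) {x : ℂ} (hx : x ∈ Metric.ball (0 : ℂ) r) :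
    Summable fun n => b n * x ^ n :=
  .of_norm_bounded (summable_geometric_of_lt_one (mul_nonneg hM hr) hMr) (norm_term_le hb hx)

lemma hasEulerDerivAt_pser {b : ℕ → ℂ} {M r : ℝ} (hM : 0 ≤ M) (hr : 0 ≤ r) (hMr : M * r < 1)
    (hb : ∀ n, ‖b n‖ ≤ M ^ n) {x : ℂ} (hx : x ∈ Metric.ball (0 : ℂ) r) :
    HasEulerDerivAt (pser b) (pser (fun n => n * b n) x) x := by
  have hs := summable_geometric_of_lt_one (mul_nonneg hM hr) hMr
  have hterm : ∀ n, DifferentiableOn ℂ (fun w : ℂ => b n * w ^ n) (Metric.ball 0 r) :=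
    fun n => by fun_prop
  have hd := differentiableOn_tsum_of_summable_norm hs hterm Metric.isOpen_ball
    fun n w hw => norm_term_le hb hw n
  refine ⟨_, (hd.differentiableAt (Metric.isOpen_ball.mem_nhds hx)).hasDerivAt, ?_⟩
  have h := hasSum_deriv_of_summable_norm hs hterm Metric.isOpen_ball
    (fun n w hw => norm_term_le hb hw n) hx
  rw [← (h.mul_left x).tsum_eq, pser]
  refine tsum_congr fun n => ?_
  rcases n with _ | n
  · simp
  · rw [((hasDerivAt_pow (n + 1) x).const_mul (b (n + 1))).deriv, Nat.add_sub_cancel]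
    ring

/-- The coefficients `(-1)^k (3k)! / (k!)^3`. -/
def hypCoeff (k : ℕ) : ℂ := (-1) ^ k * (3 * k)! / (k ! : ℂ) ^ 3

lemma hypCoeff_zero : hypCoeff 0 = 1 := by simp [hypCoeff]

lemma hypCoeff_succ (k : ℕ) :
    ((k : ℂ) + 1) ^ 2 * hypCoeff (k + 1) = -(27 * k ^ 2 + 27 * k + 6) * hypCoeff k := by
  have h1 : ((3 * (k + 1))! : ℂ) = (3 * k + 3) * (3 * k + 2) * (3 * k + 1) * (3 * k)! := by
    rw [show 3 * (k + 1) = 3 * k + 1 + 1 + 1 by ring, Nat.factorial_succ, Nat.factorial_succ,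
      Nat.factorial_succ]
    push_cast
    ring
  have h2 : (k ! : ℂ) ≠ 0 := by exact_mod_cast Nat.factorial_ne_zero k
  have h3 : (k + 1 : ℂ) ≠ 0 := by exact_mod_cast Nat.succ_ne_zero k
  rw [hypCoeff, hypCoeff, h1, Nat.factorial_succ]
  push_cast
  field_simp
  ring

lemma norm_hypCoeff_le (k : ℕ) : ‖hypCoeff k‖ ≤ 27 ^ k := by
  induction k with
  | zero => simp [hypCoeff_zero]
  | succ k ih =>
    have h := congrArg norm (hypCoeff_succ k)
    have e1 : ‖((k : ℂ) + 1) ^ 2‖ = ((k : ℝ) + 1) ^ 2 := by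
      rw [norm_pow]; congr 1; exact_mod_cast Complex.norm_natCast (k + 1)
    have e2 : ‖-(27 * (k : ℂ) ^ 2 + 27 * k + 6)‖ = 27 * (k : ℝ) ^ 2 + 27 * k + 6 := by
      rw [norm_neg]; exact_mod_cast Complex.norm_natCast (27 * k ^ 2 + 27 * k + 6)
    rw [norm_mul, norm_mul, e1, e2] at h
    have h3 : (0 : ℝ) < ((k : ℝ) + 1) ^ 2 := by positivity
    rw [← mul_le_mul_iff_right₀ h3, h, pow_succ]
    have h4 : 27 * (k : ℝ) ^ 2 + 27 * k + 6 ≤ ((k : ℝ) + 1) ^ 2 * 27 := by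
      have : (0 : ℝ) ≤ k := k.cast_nonneg
      nlinarith
    calc (27 * (k : ℝ) ^ 2 + 27 * k + 6) * ‖hypCoeff k‖
        ≤ (((k : ℝ) + 1) ^ 2 * 27) * 27 ^ k := by gcongr
      _ = _ := by ring

/-- Because n ≤ 2ⁿ, each Euler derivative keeps a geometric bound at the price of a factor 2; two of
them turn 27 into 108, which is why the radius 1/200 is sufficient. -/
lemma norm_natCast_mul_le {b : ℕ → ℂ} {M : ℝ} (hb : ∀ n, ‖b n‖ ≤ M ^ n) (n : ℕ) :
    ‖(n : ℂ) * b n‖ ≤ (2 * M) ^ n := by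
  rw [norm_mul, mul_pow, Complex.norm_natCast]
  have : (n : ℝ) ≤ 2 ^ n := by exact_mod_cast (Nat.lt_two_pow_self).le
  exact mul_le_mul this (hb n) (norm_nonneg _) (by positivity)

/-- The hypergeometric series `∑ (-1)^k (3k)! / (k!)^3 x^k`. -/
def hyp : ℂ → ℂ := pser hypCoeff

/-- The image of `hyp` under `x d/dx`. -/
def hypEuler : ℂ → ℂ := pser fun n => n * hypCoeff n

lemma hyp_zero : hyp 0 = 1 := by
  rw [hyp, pser, tsum_eq_single 0 (by simp +contextual)]
  simp [hypCoeff_zero]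

lemma hypEuler_zero : hypEuler 0 = 0 := by
  rw [hypEuler, pser, tsum_eq_single 0 (by simp +contextual)]
  simp

lemma hasEulerDerivAt_hyp {x : ℂ} (hx : x ∈ Metric.ball (0 : ℂ) (1 / 200)) :
    HasEulerDerivAt hyp (hypEuler x) x :=
  hasEulerDerivAt_pser (M := 27) (by norm_num) (by norm_num) (by norm_num) norm_hypCoeff_le hx

/-- The hypergeometric equation, equivalent to the two-term recurrence `hypCoeff_succ`. -/
lemma hasEulerDerivAt_hypEuler {x : ℂ} (hx : x ∈ Metric.ball (0 : ℂ) (1 / 200)) :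
    ∃ v, HasEulerDerivAt hypEuler v x ∧
      (1 + 27 * x) * v = -(27 * x * hypEuler x + 6 * x * hyp x) := by
  have hb1 := norm_natCast_mul_le norm_hypCoeff_le
  have hb2 := norm_natCast_mul_le hb1
  refine ⟨_, hasEulerDerivAt_pser (M := 2 * 27) (by norm_num) (by norm_num) (by norm_num) hb1 hx,
    ?_⟩
  have s0 := summable_pser (M := 27) (by norm_num) (by norm_num) (by norm_num) norm_hypCoeff_le hx
  have s1 := summable_pser (M := 2 * 27) (by norm_num) (by norm_num) (by norm_num) hb1 hx
  have s2 := summable_pser (M := 2 * (2 * 27)) (by norm_num) (by norm_num) (by norm_num) hb2 hx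
  have e : pser (fun n => n * (n * hypCoeff n)) x =
      -(27 * x * pser (fun n => n * (n * hypCoeff n)) x + 27 * x * hypEuler x + 6 * x * hyp x) := by
    -- The zeroth term carries the factor n² = 0, so the series can be shifted by one and the
    -- recurrence applied termwise.
    conv_lhs => rw [pser, s2.tsum_eq_zero_add]
    rw [hypEuler, hyp, pser, pser, pser, ← tsum_mul_left, ← tsum_mul_left, ← tsum_mul_left,
      ← (s2.mul_left _).tsum_add (s1.mul_left _),
      ← ((s2.mul_left _).add (s1.mul_left _)).tsum_add (s0.mul_left _), ← tsum_neg]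
    simp only [CharP.cast_eq_zero, zero_mul, zero_add]
    refine tsum_congr fun n => ?_
    have h := hypCoeff_succ n
    push_cast
    rw [pow_succ]
    linear_combination x ^ n * x * h
  linear_combination e

/-- The coefficient at 0 is set to 0 by hand: with truncated subtraction the general formula would
give 3 there. -/
lemma barI1_eq_pser (x : ℂ) : barI1 x =
    pser (fun k => if k = 0 then 0 else 3 * ((3 * k - 1)! : ℂ) / (k ! : ℂ) ^ 3 * (-1) ^ k) x := by
  rw [barI1, pser, ← tsum_mul_left, ← PNat.coe_injective.tsum_eq]
  · refine tsum_congr fun k => ?_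
    rw [if_neg k.ne_zero]
    ring
  · intro k hk
    rcases eq_or_ne k 0 with rfl | h0
    · simp at hk
    · exact ⟨⟨k, Nat.pos_of_ne_zero h0⟩, rfl⟩

lemma genI11_eq_hyp {x : ℂ} (hx : x ∈ Metric.ball (0 : ℂ) (1 / 200)) : genI11 x = hyp x := by
  set b : ℕ → ℂ := fun k => if k = 0 then 0 else 3 * ((3 * k - 1)! : ℂ) / (k ! : ℂ) ^ 3 * (-1) ^ k
    with hb
  have hkb : ∀ k : ℕ, k ≠ 0 → (k : ℂ) * b k = hypCoeff k := by
    intro k hk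
    obtain ⟨m, rfl⟩ := Nat.exists_eq_succ_of_ne_zero hk
    have h1 : ((3 * (m + 1))! : ℂ) = (3 * (m + 1)) * (3 * (m + 1) - 1)! := by
      rw [← Nat.mul_factorial_pred (by omega)]
      push_cast
      ring
    simp only [hb, hk, if_false, hypCoeff, Nat.succ_eq_add_one, h1]
    push_cast
    ring
  have hbnorm : ∀ k, ‖b k‖ ≤ 27 ^ k := by
    intro k
    rcases eq_or_ne k 0 with rfl | hk
    · simp [hb]
    · refine le_trans ?_ (norm_hypCoeff_le k)
      rw [← hkb k hk, norm_mul, Complex.norm_natCast]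
      exact le_mul_of_one_le_left (norm_nonneg _) (by exact_mod_cast Nat.one_le_iff_ne_zero.mpr hk)
  have hI : barI1 = pser b := funext barI1_eq_pser
  have s0 := summable_pser (M := 27) (by norm_num) (by norm_num) (by norm_num) norm_hypCoeff_le hx
  have h1 := hasEulerDerivAt_pser (M := 27) (by norm_num) (by norm_num) (by norm_num) hbnorm hx
  have s1 := summable_pser (M := 2 * 27) (by norm_num) (by norm_num) (by norm_num)
    (norm_natCast_mul_le hbnorm) hx
  rw [genI11, hI, h1.mul_deriv, hyp, pser, pser, s0.tsum_eq_zero_add, s1.tsum_eq_zero_add]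
  simp only [hypCoeff_zero, CharP.cast_eq_zero, zero_mul, zero_add, pow_zero, mul_one]
  congr 1
  exact tsum_congr fun k => by rw [hkb _ k.succ_ne_zero]

/-! ### The coordinate `q` and the functions `I₁₁` and `S` near the cusp -/

/-- The coordinate `q` as a function of the nome. -/
def discQ (z : ℂ) : ℂ := ((1 + 27 * (discD z / discC z))⁻¹ - 1) / 27

lemma one_add_discD_div_discC {z : ℂ} (hz : z ∈ Metric.ball (0 : ℂ) 1) :
    1 + 27 * (discD z / discC z) = discA z ^ 3 / discC z := by
  have hC := discC_ne_zero hz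
  rw [discA_pow_three hz, discG]
  field_simp

lemma discQ_eq {z : ℂ} (hz : z ∈ Metric.ball (0 : ℂ) 1) :
    discQ z = (discC z / discA z ^ 3 - 1) / 27 := by
  rw [discQ, one_add_discD_div_discC hz, inv_div]

lemma discQ_zero : discQ 0 = 0 := by simp [discQ, discD_zero]

/-- This converts derivations: z d/dz = (C/A) · q d/dq. -/
lemma hasEulerDerivAt_discQ {z : ℂ} (hz : z ∈ Metric.ball (0 : ℂ) 1) (hA : discA z ≠ 0) :
    HasEulerDerivAt discQ (discQ z * (discC z / discA z)) z := by
  have h := ((((hasEulerDerivAt_discC hz).div ((hasEulerDerivAt_discA hz hA).pow 3)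
    (pow_ne_zero 3 hA)).sub_const 1).const_mul (1 / 27)).congr_fun (g := discQ) (by
    filter_upwards [Metric.isOpen_ball.mem_nhds hz] with w hw
    rw [discQ_eq hw]; ring)
  refine h.congr ?_
  rw [discQ_eq hz]
  norm_num
  field_simp
  ring

lemma exists_radius_discQ_mem_ball : ∃ ε : ℝ, 0 < ε ∧ ∀ z ∈ Metric.ball (0 : ℂ) ε,
    z ∈ Metric.ball (0 : ℂ) 1 ∧ discA z ≠ 0 ∧ discQ z ∈ Metric.ball (0 : ℂ) (1 / 200) := by
  have hball := Metric.ball_mem_nhds (0 : ℂ) one_pos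
  have h1 : ∀ᶠ z in 𝓝 (0 : ℂ), discA z ≠ 0 :=
    (differentiableOn_discA.differentiableAt hball).continuousAt.eventually_ne
      (by simp [discA_zero])
  have h2 : ∀ᶠ z in 𝓝 (0 : ℂ), discQ z ∈ Metric.ball (0 : ℂ) (1 / 200) := by
    have hc := (hasEulerDerivAt_discQ zero_mem_unit_ball
      (by simp [discA_zero])).differentiableAt.continuousAt
    refine hc.eventually_mem ?_
    rw [discQ_zero]
    exact Metric.ball_mem_nhds _ (by norm_num)
  obtain ⟨ε, hε, h⟩ := Metric.eventually_nhds_iff_ball.mp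
    ((eventually_mem_set.mpr hball).and (h1.and h2))
  exact ⟨ε, hε, h⟩

/-- The image of `discA` under `q d/dq`. -/
def eulerA (z : ℂ) : ℂ :=
  discA z ^ 2 * discB z / (6 * discC z) + discA z ^ 4 / (6 * discC z) - discA z / 3

/-- A solves the hypergeometric equation in q. Write θ = q d/dq. Dividing (1 + 27q)θ²A = -(27qθA +
6qA) by 1 + 27q = C/A³ and multiplying by the conversion factor C/A leaves the factor A². -/
lemma hasEulerDerivAt_eulerA {z : ℂ} (hz : z ∈ Metric.ball (0 : ℂ) 1) (hA : discA z ≠ 0) :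
    HasEulerDerivAt eulerA
      (-(27 * discQ z * eulerA z + 6 * discQ z * discA z) * discA z ^ 2) z := by
  have hC := discC_ne_zero hz
  have a := hasEulerDerivAt_discA hz hA
  have c := (hasEulerDerivAt_discC hz).const_mul 6
  have hC6 : 6 * discC z ≠ 0 := mul_ne_zero (by norm_num) hC
  have h := ((((a.pow 2).mul (hasEulerDerivAt_discB hz)).div c hC6).add
    ((a.pow 4).div c hC6)).sub (a.const_mul (1 / 3))
  refine (h.congr_fun (g := eulerA) (.of_forall fun w => by rw [eulerA]; ring)).congr ?_
  rw [eulerA, discQ_eq hz]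
  norm_num
  field_simp
  ring

lemma hyp_discQ {ε : ℝ} (hε : 0 < ε) (h : ∀ z ∈ Metric.ball (0 : ℂ) ε,
    z ∈ Metric.ball (0 : ℂ) 1 ∧ discA z ≠ 0 ∧ discQ z ∈ Metric.ball (0 : ℂ) (1 / 200)) :
    ∀ z ∈ Metric.ball (0 : ℂ) ε, hyp (discQ z) = discA z ∧ hypEuler (discQ z) = eulerA z := by
  have hu : ∀ z ∈ Metric.ball (0 : ℂ) ε, HasEulerDerivAt (fun z => hyp (discQ z))
      (hypEuler (discQ z) * (discC z / discA z)) z := fun z hz => by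
    obtain ⟨h1, hA, hq⟩ := h z hz
    exact (hasEulerDerivAt_hyp hq).comp (hasEulerDerivAt_discQ h1 hA)
  -- Abel's identity: the Wronskian of two solutions times 1 + 27q = C/A³ is constant.
  have hW : ∀ z ∈ Metric.ball (0 : ℂ) ε, HasEulerDerivAt (fun z =>
      (discA z * hypEuler (discQ z) - hyp (discQ z) * eulerA z) * (discC z / discA z ^ 3)) 0 z := by
    intro z hz
    obtain ⟨h1, hA, hq⟩ := h z hz
    have hC := discC_ne_zero h1
    obtain ⟨v, hv, hv'⟩ := hasEulerDerivAt_hypEuler hq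
    have hT := hv.comp (hasEulerDerivAt_discQ h1 hA)
    have a := hasEulerDerivAt_discA h1 hA
    have hW := ((a.mul hT).sub ((hu z hz).mul (hasEulerDerivAt_eulerA h1 hA))).mul
      ((hasEulerDerivAt_discC h1).div (a.pow 3) (pow_ne_zero 3 hA))
    refine hW.congr ?_
    have hv2 : v = -(27 * discQ z * hypEuler (discQ z) + 6 * discQ z * hyp (discQ z)) *
        discA z ^ 3 / discC z := by
      rw [← hv', discQ_eq h1]
      field_simp
      ring
    rw [hv2]
    have hs : discA z * discB z / 6 + discA z ^ 3 / 6 - discC z / 3 =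
        eulerA z * discC z / discA z := by
      rw [eulerA]; field_simp
    rw [hs, discQ_eq h1]
    norm_num
    have hB : discB z = (eulerA z + discA z / 3 - discA z ^ 4 / (6 * discC z)) *
        (6 * discC z) / discA z ^ 2 := by
      rw [eulerA]; field_simp; ring
    rw [hB]
    field_simp
    ring
  have hAT : ∀ z ∈ Metric.ball (0 : ℂ) ε,
      discA z * hypEuler (discQ z) = hyp (discQ z) * eulerA z := by
    intro z hz
    obtain ⟨h1, hA, hq⟩ := h z hz
    have := eq_of_hasEulerDerivAt_zero hε hW z hz
    -- The constant is 0, as both solutions have zero Euler derivative at the cusp: for A it is 1/6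
    -- + 1/6 - 1/3.
    norm_num [discQ_zero, hypEuler_zero, eulerA, discA_zero, discB_zero, discC_zero] at this
    rcases this with h' | h'
    · rw [eulerA]; linear_combination h'
    · exact absurd h' (by simp [hA, discC_ne_zero h1])
  have hconst : ∀ z ∈ Metric.ball (0 : ℂ) ε,
      HasEulerDerivAt (fun z => hyp (discQ z) / discA z) 0 z := by
    intro z hz
    obtain ⟨h1, hA, hq⟩ := h z hz
    refine ((hu z hz).div (hasEulerDerivAt_discA h1 hA) hA).congr ?_
    have hC := discC_ne_zero h1
    have hs : discA z * discB z / 6 + discA z ^ 3 / 6 - discC z / 3 =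
        eulerA z * discC z / discA z := by
      rw [eulerA]; field_simp
    rw [hs, div_eq_zero_iff]
    left
    field_simp
    linear_combination discC z * hAT z hz
  intro z hz
  obtain ⟨h1, hA, hq⟩ := h z hz
  have e := eq_of_hasEulerDerivAt_zero hε hconst z hz
  simp only [discQ_zero, hyp_zero, discA_zero, div_one] at e
  have e' : hyp (discQ z) = discA z := (div_eq_one_iff_eq hA).mp e
  refine ⟨e', mul_left_cancel₀ hA ?_⟩
  rw [hAT z hz, e']

lemma genI11_discQ : ∀ᶠ z in 𝓝 (0 : ℂ), genI11 (discQ z) = discA z := by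
  obtain ⟨ε, hε, h⟩ := exists_radius_discQ_mem_ball
  filter_upwards [Metric.ball_mem_nhds 0 hε] with z hz
  rw [genI11_eq_hyp (h z hz).2.2, (hyp_discQ hε h z hz).1]

lemma genS_discQ : ∀ᶠ z in 𝓝 (0 : ℂ),
    genS (discQ z) = discA z * (discB z - discA z ^ 2) / (6 * discC z) := by
  obtain ⟨ε, hε, h⟩ := exists_radius_discQ_mem_ball
  filter_upwards [Metric.ball_mem_nhds 0 hε] with z hz
  obtain ⟨h1, hA, hq⟩ := h z hz
  have hC := discC_ne_zero h1
  obtain ⟨e1, e2⟩ := hyp_discQ hε h z hz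
  have h27 : 1 + 27 * discQ z = discC z / discA z ^ 3 := by rw [discQ_eq h1]; ring
  have h27' : 1 + 27 * discQ z ≠ 0 := by rw [h27]; exact div_ne_zero hC (pow_ne_zero 3 hA)
  have hI : discQ z * logDeriv genI11 (discQ z) = eulerA z / discA z := by
    have := (hasEulerDerivAt_hyp hq).congr_fun (g := genI11) (by
      filter_upwards [Metric.isOpen_ball.mem_nhds hq] with w hw using genI11_eq_hyp hw)
    rw [logDeriv_apply, ← mul_div_assoc, this.mul_deriv, genI11_eq_hyp hq, e1, e2]
  have hX : logDeriv genX (discQ z) = -27 / (1 + 27 * discQ z) := by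
    have hd : HasDerivAt (fun q : ℂ => 1 + 27 * q) 27 (discQ z) := by
      simpa using ((hasDerivAt_id (discQ z)).const_mul (27 : ℂ)).const_add 1
    have := hd.inv h27'
    rw [logDeriv_apply, genX, show genX = (fun q : ℂ => 1 + 27 * q)⁻¹ from rfl, this.deriv]
    field_simp
  rw [genS, mul_sub, hI, hX, h27, discQ_eq h1, eulerA]
  field_simp
  ring

/-! ### Existence and uniqueness of the functions on the upper half-plane -/

lemma funC_eq (τ : ℍ) : funC τ = discC (nome τ) := by rw [funC, discC_nome]

lemma eisenstein_one_three (τ : ℍ) : eisenstein 1 (3 * τ) = discE2 (nome τ ^ 3) := by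
  rw [← nome_three_mul]; exact eisenstein_one ⟨3 * τ, im_three_mul_pos τ.2⟩

lemma eisenstein_two_three (τ : ℍ) : eisenstein 2 (3 * τ) = discE4 (nome τ ^ 3) := by
  rw [← nome_three_mul]; exact eisenstein_two ⟨3 * τ, im_three_mul_pos τ.2⟩

lemma eisenstein_three_three (τ : ℍ) : eisenstein 3 (3 * τ) = discE6 (nome τ ^ 3) := by
  rw [← nome_three_mul]; exact eisenstein_three ⟨3 * τ, im_three_mul_pos τ.2⟩

lemma funB_eq (τ : ℍ) : funB τ = discB (nome τ) := by
  rw [funB, eisenstein_one, eisenstein_one_three, discB]; ring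

lemma eta_ratio_eq (τ : ℍ) :
    eta (3 * τ) ^ 12 / eta τ ^ 12 = discD (nome τ) / discC (nome τ) := by
  have hη : eta τ ≠ 0 := eta_ne_zero τ.2
  have hη3 : eta (3 * τ) ≠ 0 := eta_ne_zero (im_three_mul_pos τ.2)
  rw [discC_nome, discD_nome]
  field_simp

lemma coordQ_eq (τ : ℍ) : coordQ τ = discQ (nome τ) := by
  rw [coordQ, eta_ratio_eq, discQ]

lemma genX_coordQ (τ : ℍ) :
    genX (coordQ τ) = discA (nome τ) ^ 3 / discC (nome τ) := by
  rw [genX, coordQ_eq, discQ_eq (nome_mem_ball τ.2), mul_div_cancel₀ _ (by norm_num),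
    add_sub_cancel, inv_div]

lemma mdifferentiable_comp_nome {F : ℂ → ℂ} (hF : DifferentiableOn ℂ F (Metric.ball 0 1)) :
    MDifferentiable 𝓘(ℂ) 𝓘(ℂ) (fun τ : ℍ => F (nome τ)) :=
  mdifferentiable_of_differentiableOn (differentiableOn_comp_nome hF)

lemma eq_of_eventuallyEq_atImInfty {f g : ℍ → ℂ} (hf : MDifferentiable 𝓘(ℂ) 𝓘(ℂ) f)
    (hg : MDifferentiable 𝓘(ℂ) 𝓘(ℂ) g) (h : f =ᶠ[atImInfty] g) : f = g := by
  rw [UpperHalfPlane.mdifferentiable_iff] at hf hg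
  obtain ⟨M, hM⟩ := (atImInfty_mem _).mp h
  have hpos : 0 < (((|M| + 1 : ℝ) : ℂ) * I).im := by simp; positivity
  have heq : Set.EqOn (f ∘ ofComplex) (g ∘ ofComplex) {z : ℂ | 0 < z.im} := by
    refine (hf.analyticOnNhd isOpen_upperHalfPlaneSet).eqOn_of_preconnected_of_eventuallyEq
      (hg.analyticOnNhd isOpen_upperHalfPlaneSet) isPreconnected_upperHalfPlaneSet hpos ?_
    have hopen : IsOpen {z : ℂ | |M| < z.im} := isOpen_lt continuous_const continuous_im
    filter_upwards [hopen.mem_nhds (show |M| < (((|M| + 1 : ℝ) : ℂ) * I).im by simp)] with z hz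
    have hz0 : 0 < z.im := (abs_nonneg M).trans_lt hz
    simp only [Function.comp_apply, ofComplex_apply_of_im_pos hz0]
    exact hM ⟨z, hz0⟩ ((le_abs_self M).trans hz.le)
  ext τ
  simpa using heq τ.2

lemma isFunA_discA : IsFunA fun τ => discA (nome τ) where
  holomorphic := mdifferentiable_comp_nome differentiableOn_discA
  cube τ := by rw [discA_pow_three (nome_mem_ball τ.2), discG, discC_nome, discD_nome]
  tendsto_one := by
    have h := (differentiableOn_discA.differentiableAt
      (Metric.ball_mem_nhds 0 one_pos)).continuousAt.tendsto.comp tendsto_nome_atImInfty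
    rwa [discA_zero] at h

lemma IsFunA.unique {A A' : ℍ → ℂ} (h : IsFunA A) (h' : IsFunA A') : A = A' := by
  refine eq_of_eventuallyEq_atImInfty h.holomorphic h'.holomorphic ?_
  -- In A³ - A'³ = (A - A')(A² + AA' + A'²) the second factor tends to 3, so the roots agree near
  -- the cusp.
  have hlim : Tendsto (fun τ => A τ ^ 2 + A τ * A' τ + A' τ ^ 2) atImInfty
      (𝓝 (1 ^ 2 + 1 * 1 + 1 ^ 2)) :=
    ((h.tendsto_one.pow 2).add (h.tendsto_one.mul h'.tendsto_one)).add (h'.tendsto_one.pow 2)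
  filter_upwards [hlim.eventually_ne (b₂ := 0) (by norm_num)] with τ hτ
  have h3 : A τ ^ 3 = A' τ ^ 3 := (h.cube τ).trans (h'.cube τ).symm
  exact sub_eq_zero.mp ((mul_eq_zero.mp (show (A τ - A' τ) * _ = 0 by
    linear_combination h3)).resolve_right hτ)

lemma IsContinuation.unique {f : ℂ → ℂ} {F F' : ℍ → ℂ} (h : IsContinuation f F)
    (h' : IsContinuation f F') : F = F' :=
  eq_of_eventuallyEq_atImInfty h.holomorphic h'.holomorphic <| by
    filter_upwards [h.eq_near_cusp, h'.eq_near_cusp] with τ h1 h2 using h1.trans h2.symm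

lemma isContinuation_genI11 : IsContinuation genI11 fun τ => discA (nome τ) where
  holomorphic := mdifferentiable_comp_nome differentiableOn_discA
  eq_near_cusp := by
    filter_upwards [tendsto_nome_atImInfty.eventually genI11_discQ] with τ hτ
    rw [coordQ_eq, hτ]

lemma isContinuation_genS : IsContinuation genS fun τ =>
    discA (nome τ) * (discB (nome τ) - discA (nome τ) ^ 2) / (6 * discC (nome τ)) where
  holomorphic := mdifferentiable_comp_nome
    (F := fun z => discA z * (discB z - discA z ^ 2) / (6 * discC z))
    ((differentiableOn_discA.mul (differentiableOn_discB.sub (differentiableOn_discA.pow 2))).div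
      (differentiableOn_discC.const_mul 6)
      fun _ hz => mul_ne_zero (by norm_num) (discC_ne_zero hz))
  eq_near_cusp := by
    filter_upwards [tendsto_nome_atImInfty.eventually genS_discQ] with τ hτ
    rw [coordQ_eq, hτ]

lemma generator_identities (τ : ℍ) {X A B C S : ℂ} (hA : A = discA (nome τ))
    (hC : C = discC (nome τ)) (hS : S = A * (B - A ^ 2) / (6 * C))
    (hX : X = genX (coordQ τ)) (hX0 : X ≠ 0) :
    2 * B + A ^ 2 = 3 * A ^ 2 / X * (X + 4 * S) ∧
    A ^ 4 + 8 * A * C = A ^ 4 / X * (X + 8) ∧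
    -A ^ 6 + 20 * A ^ 3 * C + 8 * C ^ 2 = -A ^ 6 / X ^ 2 * (X ^ 2 - 20 * X - 8) := by
  have hC0 : C ≠ 0 := hC ▸ discC_ne_zero (nome_mem_ball τ.2)
  have hX' : X = A ^ 3 / C := by rw [hX, genX_coordQ, hA, hC]
  -- X = A³/C vanishes exactly where A does, so X ≠ 0 is what the divisions need.
  have hA0 : A ≠ 0 := by rintro rfl; simp [hX'] at hX0
  rw [hX', hS]
  refine ⟨?_, ?_, ?_⟩ <;> field_simp <;> ring

/-! ### Independence of the weights -/

lemma aeval_weighted_smul {σ : Type*} {w : σ → ℕ} {p : MvPolynomial σ ℚ} {k : ℕ}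
    (hp : p.IsWeightedHomogeneous w k) (l : ℂ) (x : σ → ℂ) :
    MvPolynomial.aeval (fun i => l ^ w i * x i) p = l ^ k * MvPolynomial.aeval x p := by
  rw [MvPolynomial.aeval_def, MvPolynomial.aeval_def, MvPolynomial.eval₂_eq, MvPolynomial.eval₂_eq,
    Finset.mul_sum]
  refine Finset.sum_congr rfl fun d hd => ?_
  have hw := hp (MvPolynomial.mem_support_iff.mp hd)
  rw [← hw, Finsupp.weight_apply, Finsupp.sum, ← Finset.prod_pow_eq_pow_sum]
  simp only [mul_pow, Finset.prod_mul_distrib, ← pow_mul, smul_eq_mul, mul_comm (w _)]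
  ring

lemma eval_aeval_polynomial {σ : Type*} (p : MvPolynomial σ ℚ) (x : σ → Polynomial ℂ) (t : ℂ) :
    (MvPolynomial.aeval x p).eval t = MvPolynomial.aeval (fun i => (x i).eval t) p := by
  have := MvPolynomial.map_aeval (R := ℚ) (B := ℂ) x (Polynomial.evalRingHom t) p
  rw [Polynomial.coe_evalRingHom] at this
  rw [this, MvPolynomial.aeval_def, Subsingleton.elim ((Polynomial.evalRingHom t).comp
    (algebraMap ℚ (Polynomial ℂ))) (algebraMap ℚ ℂ)]
  rfl

lemma polynomial_eq_zero_of_eval_inv_add_nat {Q : Polynomial ℂ} {τ : ℂ}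
    (h : ∀ n : ℕ, Q.eval (τ + n)⁻¹ = 0) : Q = 0 := by
  refine Q.eq_zero_of_infinite_isRoot (Set.Infinite.mono (s := Set.range fun n : ℕ => (τ + n)⁻¹)
    ?_ (Set.infinite_range_of_injective fun m n hmn => ?_))
  · rintro _ ⟨n, rfl⟩
    exact h n
  · simpa using hmn

/-- The constant `-i√3`, by which the Fricke involution scales weights. -/
def frickeConst : ℂ := -I * (Real.sqrt 3 : ℝ)

lemma frickeConst_sq : frickeConst ^ 2 = -3 := by
  rw [frickeConst, mul_pow, neg_sq, I_sq, sqrt_three_sq]; ring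

lemma frickeConst_ne_zero : frickeConst ≠ 0 := by
  intro h; have := frickeConst_sq; rw [h] at this; norm_num at this

lemma im_neg_one_div_three_mul_pos {τ : ℂ} (hτ : 0 < τ.im) : 0 < (-1 / (3 * τ)).im :=
  im_neg_one_div_pos (im_three_mul_pos hτ)

lemma discA_fricke {τ : ℂ} (hτ : 0 < τ.im) :
    discA (nome (-1 / (3 * τ))) = frickeConst * τ * discA (nome τ) := by
  have h0 : τ ≠ 0 := by rintro rfl; simp at hτ
  have hr := sqrt_three_ne_zero
  rw [discA, discA, discG_nome_neg_one_div (im_three_mul_pos hτ),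
    discP_nome_neg_one_div (im_three_mul_pos hτ), mul_div_cancel_left₀ _ three_ne_zero, frickeConst]
  by_cases hP : discP (nome τ) = 0
  · simp [hP]
  · field_simp
    rw [sqrt_three_sq]
    ring

lemma discB_fricke {τ : ℂ} (hτ : 0 < τ.im) : discB (nome (-1 / (3 * τ))) =
    (frickeConst * τ) ^ 2 * -(discB (nome τ) + 3 / (Real.pi * I) * τ⁻¹) := by
  have h0 : τ ≠ 0 := by rintro rfl; simp at hτ
  have hpi : (Real.pi : ℂ) ≠ 0 := by exact_mod_cast Real.pi_ne_zero
  rw [discB_nome_neg_one_div (im_three_mul_pos hτ), mul_div_cancel_left₀ _ three_ne_zero,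
    mul_pow frickeConst, frickeConst_sq]
  field_simp

/-- Writing 27D as A³ - C keeps the involution within polynomials in A, B and C. -/
lemma discC_fricke {τ : ℂ} (hτ : 0 < τ.im) : discC (nome (-1 / (3 * τ))) =
    (frickeConst * τ) ^ 3 * (discA (nome τ) ^ 3 - discC (nome τ)) := by
  rw [discC_nome_neg_one_div (im_three_mul_pos hτ), mul_div_cancel_left₀ _ three_ne_zero,
    discA_pow_three (nome_mem_ball hτ), discG, mul_pow frickeConst, pow_succ frickeConst,
    frickeConst_sq, frickeConst]
  ring

lemma coeff_eq_zero_of_sum_pow_mul_eq_zero {s : Finset ℕ} {v : ℕ → ℂ}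
    (h : ∀ ρ : ℂ, ρ ≠ 0 → ∑ k ∈ s, ρ ^ k * v k = 0) : ∀ k ∈ s, v k = 0 := by
  set V : Polynomial ℂ := ∑ k ∈ s, Polynomial.C (v k) * Polynomial.X ^ k with hV
  have hV0 : V = 0 := by
    refine polynomial_eq_zero_of_eval_inv_add_nat (τ := 1) fun n => ?_
    have hn0 : (1 + n : ℂ) ≠ 0 := by rw [add_comm]; exact Nat.cast_add_one_ne_zero n
    rw [hV, Polynomial.eval_finsetSum, ← h _ (inv_ne_zero hn0)]
    refine Finset.sum_congr rfl fun k hk => ?_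
    rw [Polynomial.eval_mul, Polynomial.eval_C, Polynomial.eval_pow, Polynomial.eval_X, mul_comm]
  intro k hk
  have := congrArg (fun P => Polynomial.coeff P k) hV0
  simpa [hV, Polynomial.finsetSum_coeff, Polynomial.coeff_C_mul, Polynomial.coeff_X_pow, hk]
    using this

section Independence

variable {s : Finset ℕ} {p : ℕ → MvPolynomial (Fin 3) ℚ}

lemma sum_fricke_eq_zero (hp : ∀ k ∈ s, (p k).IsWeightedHomogeneous ![1, 2, 3] k)
    (h : ∀ τ : ℂ, 0 < τ.im → ∑ k ∈ s, MvPolynomial.aeval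
      ![discA (nome τ), discB (nome τ), discC (nome τ)] (p k) = 0) {τ : ℂ} (hτ : 0 < τ.im) :
    ∑ k ∈ s, (frickeConst * τ) ^ k * MvPolynomial.aeval ![discA (nome τ),
      -(discB (nome τ) + 3 / (Real.pi * I) * τ⁻¹), discA (nome τ) ^ 3 - discC (nome τ)] (p k)
      = 0 := by
  rw [← h _ (im_neg_one_div_three_mul_pos hτ)]
  refine Finset.sum_congr rfl fun k hk => ?_
  rw [← aeval_weighted_smul (hp k hk)]
  congr 2
  ext i
  fin_cases i
  · simp [discA_fricke hτ]
  · simpa using (discB_fricke hτ).symm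
  · simpa using (discC_fricke hτ).symm

/-- A, B and C have period 1, so replacing τ by τ + n changes only the explicit τ. The relation thus
holds at infinitely many values of 1/τ and is polynomial in it after clearing denominators. -/
lemma sum_fricke_param_eq_zero (hp : ∀ k ∈ s, (p k).IsWeightedHomogeneous ![1, 2, 3] k)
    (h : ∀ τ : ℂ, 0 < τ.im → ∑ k ∈ s, MvPolynomial.aeval
      ![discA (nome τ), discB (nome τ), discC (nome τ)] (p k) = 0) {τ : ℂ} (hτ : 0 < τ.im)
    {μ : ℂ} (hμ : μ ≠ 0) :
    ∑ k ∈ s, (frickeConst / μ) ^ k * MvPolynomial.aeval ![discA (nome τ),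
      -(discB (nome τ) + 3 / (Real.pi * I) * μ), discA (nome τ) ^ 3 - discC (nome τ)] (p k)
      = 0 := by
  -- `K` is the largest weight that occurs; multiplying by μ^K clears the powers of 1/μ.
  set K := s.sup id with hK
  have hle : ∀ k ∈ s, k ≤ K := fun k hk => Finset.le_sup (f := id) hk
  set Q : Polynomial ℂ := ∑ k ∈ s, Polynomial.C (frickeConst ^ k) * Polynomial.X ^ (K - k) *
    MvPolynomial.aeval ![Polynomial.C (discA (nome τ)), -(Polynomial.C (discB (nome τ)) +
      Polynomial.C (3 / (Real.pi * I)) * Polynomial.X),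
      Polynomial.C (discA (nome τ) ^ 3 - discC (nome τ))] (p k) with hQ
  have heval : ∀ t : ℂ, t ≠ 0 → Q.eval t = t ^ K * ∑ k ∈ s, (frickeConst / t) ^ k *
      MvPolynomial.aeval ![discA (nome τ), -(discB (nome τ) + 3 / (Real.pi * I) * t),
        discA (nome τ) ^ 3 - discC (nome τ)] (p k) := by
    intro t ht
    rw [hQ, Polynomial.eval_finsetSum, Finset.mul_sum]
    refine Finset.sum_congr rfl fun k hk => ?_
    rw [Polynomial.eval_mul, Polynomial.eval_mul, Polynomial.eval_C, Polynomial.eval_pow,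
      Polynomial.eval_X, eval_aeval_polynomial, ← mul_assoc, pow_sub₀ _ ht (hle k hk), div_pow]
    congr 1
    · ring
    · congr 2
      ext i
      fin_cases i <;> simp
  have hzero : Q = 0 := by
    refine polynomial_eq_zero_of_eval_inv_add_nat (τ := τ) fun n => ?_
    have hn : 0 < (τ + n).im := by simpa using hτ
    have hn0 : τ + n ≠ 0 := by intro h0; rw [h0] at hn; simp at hn
    have := sum_fricke_eq_zero hp h hn
    rw [nome_add_nat] at this
    rw [heval _ (inv_ne_zero hn0), div_inv_eq_mul, this, mul_zero]
  have := heval μ hμ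
  rw [hzero, Polynomial.eval_zero, eq_comm, mul_eq_zero] at this
  exact this.resolve_left (pow_ne_zero _ hμ)

lemma sum_shift_eq_zero (hp : ∀ k ∈ s, (p k).IsWeightedHomogeneous ![1, 2, 3] k)
    (h : ∀ τ : ℂ, 0 < τ.im → ∑ k ∈ s, MvPolynomial.aeval
      ![discA (nome τ), discB (nome τ), discC (nome τ)] (p k) = 0) {τ : ℂ} (hτ : 0 < τ.im)
    {ρ : ℂ} (hρ : ρ ≠ 0) :
    ∑ k ∈ s, ρ ^ k * MvPolynomial.aeval ![discA (nome τ),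
      discB (nome τ) + 3 / (Real.pi * I) * (1 - ρ⁻¹) * τ⁻¹, discC (nome τ)] (p k) = 0 := by
  have h0 : τ ≠ 0 := by rintro rfl; simp at hτ
  have hf := frickeConst_ne_zero
  have hf2 := frickeConst_sq
  have hpi : (Real.pi : ℂ) ≠ 0 := by exact_mod_cast Real.pi_ne_zero
  -- This parameter is chosen so that the second involution combines with the first to scale by
  -- (c/μ)(cτ) = -3τ/μ = ρ, where c = `frickeConst`.
  have hμ : -3 * τ / ρ ≠ 0 := div_ne_zero (mul_ne_zero (by norm_num) h0) hρ
  rw [← sum_fricke_param_eq_zero hp h (im_neg_one_div_three_mul_pos hτ) hμ]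
  refine Finset.sum_congr rfl fun k hk => ?_
  have hl : ρ = frickeConst / (-3 * τ / ρ) * (frickeConst * τ) := by
    field_simp
    rw [hf2]
    ring
  conv_lhs => rw [hl, mul_pow, mul_assoc, ← aeval_weighted_smul (hp k hk), ← hl]
  congr 3
  ext i
  fin_cases i
  · simp [discA_fricke hτ]
  · simp only [discB_fricke hτ, Fin.mk_one, Matrix.cons_val_one, Matrix.cons_val_zero, mul_pow, hf2]
    field_simp
    ring
  · simp only [discA_fricke hτ, discC_fricke hτ, Fin.reduceFinMk, Matrix.cons_val]
    ring

theorem aeval_eq_zero_of_sum_eq_zero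
    (hp : ∀ k ∈ s, (p k).IsWeightedHomogeneous ![1, 2, 3] k)
    (h : ∀ τ : ℂ, 0 < τ.im → ∑ k ∈ s, MvPolynomial.aeval
      ![discA (nome τ), discB (nome τ), discC (nome τ)] (p k) = 0) {τ : ℂ} (hτ : 0 < τ.im) :
    ∀ k ∈ s, MvPolynomial.aeval
      ![discA (nome τ), discB (nome τ), discC (nome τ)] (p k) = 0 := by
  have hscale : ∀ ρ : ℂ, ρ ≠ 0 → ∑ k ∈ s, ρ ^ k * MvPolynomial.aeval
      ![discA (nome τ), discB (nome τ), discC (nome τ)] (p k) = 0 := by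
    intro ρ hρ
    -- Periodicity again makes 1/τ a free variable; setting it to 0 removes the shift of B and
    -- leaves only the scaling ρ^k.
    set R : Polynomial ℂ := ∑ k ∈ s, Polynomial.C (ρ ^ k) *
      MvPolynomial.aeval ![Polynomial.C (discA (nome τ)), Polynomial.C (discB (nome τ)) +
        Polynomial.C (3 / (Real.pi * I) * (1 - ρ⁻¹)) * Polynomial.X,
        Polynomial.C (discC (nome τ))] (p k) with hR
    have heval : ∀ t : ℂ, R.eval t = ∑ k ∈ s, ρ ^ k *
        MvPolynomial.aeval ![discA (nome τ), discB (nome τ) + 3 / (Real.pi * I) * (1 - ρ⁻¹) * t,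
          discC (nome τ)] (p k) := by
      intro t
      rw [hR, Polynomial.eval_finsetSum]
      refine Finset.sum_congr rfl fun k hk => ?_
      rw [Polynomial.eval_mul, Polynomial.eval_C, eval_aeval_polynomial]
      congr 3
      ext i
      fin_cases i <;> simp
    have hzero : R = 0 := by
      refine polynomial_eq_zero_of_eval_inv_add_nat (τ := τ) fun n => ?_
      have hn : 0 < (τ + n).im := by simpa using hτ
      have := sum_shift_eq_zero hp h hn hρ
      rw [nome_add_nat] at this
      rw [heval, this]
    have := heval 0
    simp only [hzero, Polynomial.eval_zero, mul_zero, add_zero] at this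
    exact this.symm
  exact coeff_eq_zero_of_sum_pow_mul_eq_zero hscale

end Independence

/-! ### The gradings -/

lemma mem_genPart {w : Fin 3 → ℕ} {f : Fin 3 → ℍ → ℂ} {k : ℕ} {x : genRing f} :
    x ∈ genPart w f k ↔ ∃ p : MvPolynomial (Fin 3) ℚ, p.IsWeightedHomogeneous w k ∧
      MvPolynomial.aeval f p = (x : ℍ → ℂ) :=
  Iff.rfl

lemma iSup_genPart_eq_top (w : Fin 3 → ℕ) (f : Fin 3 → ℍ → ℂ) : ⨆ k, genPart w f k = ⊤ := by
  have hmem : ∀ p : MvPolynomial (Fin 3) ℚ, MvPolynomial.aeval f p ∈ genRing f := fun p => by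
    rw [genRing, Algebra.adjoin_range_eq_range_aeval]
    exact ⟨p, rfl⟩
  have key : ∀ p : MvPolynomial (Fin 3) ℚ,
      (⟨MvPolynomial.aeval f p, hmem p⟩ : genRing f) ∈ ⨆ k, genPart w f k := by
    intro p
    induction p using MvPolynomial.induction_on' with
    | monomial u a =>
      refine Submodule.mem_iSup_of_mem (Finsupp.weight w u) (mem_genPart.mpr
        ⟨_, MvPolynomial.isWeightedHomogeneous_monomial w u a rfl, rfl⟩)
    | add p q hp hq =>
      have : (⟨MvPolynomial.aeval f (p + q), hmem _⟩ : genRing f) =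
          ⟨MvPolynomial.aeval f p, hmem p⟩ + ⟨MvPolynomial.aeval f q, hmem q⟩ := by
        ext1; simp
      rw [this]
      exact Submodule.add_mem _ hp hq
  rw [eq_top_iff]
  rintro ⟨x, hx⟩ -
  have hx' := hx
  rw [genRing, Algebra.adjoin_range_eq_range_aeval] at hx'
  obtain ⟨p, rfl⟩ := hx'
  exact key p

lemma isInternal_genPart {w : Fin 3 → ℕ} {f : Fin 3 → ℍ → ℂ}
    (h : ∀ (s : Finset ℕ) (x : ℕ → genRing f), (∀ k ∈ s, x k ∈ genPart w f k) →
      ∑ k ∈ s, (x k : ℍ → ℂ) = 0 → ∀ k ∈ s, (x k : ℍ → ℂ) = 0) :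
    DirectSum.IsInternal (genPart w f) := by
  refine DirectSum.isInternal_submodule_of_iSupIndep_of_iSup_eq_top ?_ (iSup_genPart_eq_top w f)
  rw [iSupIndep_iff_finsetSum_eq_zero_imp_eq_zero]
  intro s x hx hs k hk
  have hs' : ∑ k ∈ s, (x k : ℍ → ℂ) = 0 := by
    have := congrArg (Subalgebra.val (genRing f)) hs
    simpa using this
  exact Subtype.ext (h s x hx hs' k hk)

/-- The functions `A`, `B`, `C`. -/
def abcGens : Fin 3 → ℍ → ℂ := ![fun τ => discA (nome τ), funB, funC]

lemma aeval_pi_apply (f : Fin 3 → ℍ → ℂ) (p : MvPolynomial (Fin 3) ℚ) (τ : ℍ) :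
    MvPolynomial.aeval f p τ = MvPolynomial.aeval (fun i => f i τ) p := by
  have := MvPolynomial.comp_aeval_apply f (Pi.evalAlgHom ℚ (fun _ : ℍ => ℂ) τ) p
  exact this

lemma abcGens_apply (τ : ℍ) : (fun i => abcGens i τ) =
    ![discA (nome τ), discB (nome τ), discC (nome τ)] := by
  ext i
  fin_cases i
  · rfl
  · exact funB_eq τ
  · exact funC_eq τ

lemma abc_independent (s : Finset ℕ) (x : ℕ → ℍ → ℂ)
    (hx : ∀ k ∈ s, ∃ p : MvPolynomial (Fin 3) ℚ, p.IsWeightedHomogeneous ![1, 2, 3] k ∧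
      MvPolynomial.aeval abcGens p = x k)
    (hs : ∑ k ∈ s, x k = 0) : ∀ k ∈ s, x k = 0 := by
  choose! p hp hpx using hx
  intro k hk
  ext τ
  rw [← hpx k hk, aeval_pi_apply, abcGens_apply]
  refine aeval_eq_zero_of_sum_eq_zero hp (fun σ hσ => ?_) τ.2 k hk
  have h := congrFun hs ⟨σ, hσ⟩
  rw [Finset.sum_apply, Pi.zero_apply] at h
  rw [← h]
  refine Finset.sum_congr rfl fun j hj => ?_
  rw [← hpx j hj, aeval_pi_apply, abcGens_apply]

/-! ### Embedding of the Eisenstein ring and transfer of the grading. -/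

/-- The Eisenstein series `E₂(3τ)`, `E₄(3τ)`, `E₆(3τ)` as polynomials in `A`, `B`, `C`. -/
def eisPoly : Fin 3 → MvPolynomial (Fin 3) ℚ :=
  open MvPolynomial in
  ![C (1 / 3) * (C 2 * X 1 + X 0 ^ 2), C (1 / 9) * (X 0 ^ 4 + C 8 * (X 0 * X 2)),
    C (1 / 27) * (C (-1) * X 0 ^ 6 + C 20 * (X 0 ^ 3 * X 2) + C 8 * X 2 ^ 2)]

lemma isWeightedHomogeneous_eisPoly (i : Fin 3) :
    (eisPoly i).IsWeightedHomogeneous ![1, 2, 3] (![2, 4, 6] i) := by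
  have hX (i : Fin 3) := MvPolynomial.isWeightedHomogeneous_X ℚ ![1, 2, 3] i
  fin_cases i
  · exact MvPolynomial.IsWeightedHomogeneous.C_mul
      (((hX 1).C_mul 2).add ((hX 0).pow 2)) _
  · exact MvPolynomial.IsWeightedHomogeneous.C_mul
      (((hX 0).pow 4).add (((hX 0).mul (hX 2)).C_mul 8)) _
  · exact MvPolynomial.IsWeightedHomogeneous.C_mul
      ((((hX 0).pow 6).C_mul (-1)).add ((((hX 0).pow 3).mul (hX 2)).C_mul 20) |>.add
        (((hX 2).pow 2).C_mul 8)) _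

lemma aeval_eisPoly (i : Fin 3) : MvPolynomial.aeval abcGens (eisPoly i) = eisGens i := by
  ext τ
  have hz := nome_mem_ball τ.2
  rw [aeval_pi_apply, abcGens_apply]
  fin_cases i
  · have h := three_mul_discE2 hz
    simp [eisPoly, eisGens, eisenstein_one_three]
    linear_combination -h / 3
  · have h := nine_mul_discE4 hz
    simp [eisPoly, eisGens, eisenstein_two_three]
    linear_combination -h / 9
  · have h := twentySeven_mul_discE6 hz
    simp [eisPoly, eisGens, eisenstein_three_three]
    linear_combination -h / 27

lemma isWeightedHomogeneous_bind₁ {σ σ' : Type*} {w : σ → ℕ} {w' : σ' → ℕ}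
    {g : σ → MvPolynomial σ' ℚ} (hg : ∀ i, (g i).IsWeightedHomogeneous w' (w i))
    {p : MvPolynomial σ ℚ} {k : ℕ} (hp : p.IsWeightedHomogeneous w k) :
    (MvPolynomial.bind₁ g p).IsWeightedHomogeneous w' k := by
  rw [MvPolynomial.bind₁, MvPolynomial.aeval_def, MvPolynomial.eval₂_eq]
  refine MvPolynomial.IsWeightedHomogeneous.sum _ _ _ fun d hd => ?_
  rw [← hp (MvPolynomial.mem_support_iff.mp hd), MvPolynomial.algebraMap_eq]
  refine MvPolynomial.IsWeightedHomogeneous.C_mul ?_ _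
  rw [Finsupp.weight_apply, Finsupp.sum]
  exact MvPolynomial.IsWeightedHomogeneous.prod _ _ _ fun i _ => (hg i).pow (d i)

/-- Substituting `eisPoly` preserves weights, which gives both the graded inclusion and the
independence of weights for the Eisenstein generators. -/
lemma exists_abc_of_eis {k : ℕ} {x : ℍ → ℂ} (hx : ∃ p : MvPolynomial (Fin 3) ℚ,
    p.IsWeightedHomogeneous ![2, 4, 6] k ∧ MvPolynomial.aeval eisGens p = x) :
    ∃ p : MvPolynomial (Fin 3) ℚ, p.IsWeightedHomogeneous ![1, 2, 3] k ∧
      MvPolynomial.aeval abcGens p = x := by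
  obtain ⟨p, hp, rfl⟩ := hx
  refine ⟨_, isWeightedHomogeneous_bind₁ isWeightedHomogeneous_eisPoly hp, ?_⟩
  rw [MvPolynomial.aeval_bind₁]
  simp only [aeval_eisPoly]

lemma genRing_eisGens_le : genRing eisGens ≤ genRing abcGens := by
  refine Algebra.adjoin_le ?_
  rintro _ ⟨i, rfl⟩
  rw [← aeval_eisPoly, genRing, Algebra.adjoin_range_eq_range_aeval]
  exact ⟨_, rfl⟩

lemma isInternal_genPart_eisGens : DirectSum.IsInternal (genPart ![2, 4, 6] eisGens) :=
  isInternal_genPart fun s x hx hs => abc_independent s (fun k => (x k : ℍ → ℂ))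
    (fun k hk => exists_abc_of_eis (mem_genPart.mp (hx k hk))) hs

lemma isInternal_genPart_abcGens : DirectSum.IsInternal (genPart ![1, 2, 3] abcGens) :=
  isInternal_genPart fun s x hx hs => abc_independent s (fun k => (x k : ℍ → ℂ))
    (fun k hk => mem_genPart.mp (hx k hk)) hs

lemma inclusion_mem_genPart_abcGens {k : ℕ} {x : genRing eisGens}
    (hx : x ∈ genPart ![2, 4, 6] eisGens k) :
    Subalgebra.inclusion genRing_eisGens_le x ∈ genPart ![1, 2, 3] abcGens k := by
  obtain ⟨p, hp, hpx⟩ := exists_abc_of_eis (mem_genPart.mp hx)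
  rw [mem_genPart, Subalgebra.coe_inclusion]
  exact ⟨p, hp, hpx⟩

end LocalP2

end


theorem proposition4p5 :
    -- the functions `A`, `I₁₁`, `S` of `τ` exist and are unique
    (∃! A : ℍ → ℂ, LocalP2.IsFunA A) ∧
    (∃! I : ℍ → ℂ, LocalP2.IsContinuation LocalP2.genI11 I) ∧
    (∃! S : ℍ → ℂ, LocalP2.IsContinuation LocalP2.genS S) ∧
    ∀ A I S : ℍ → ℂ, LocalP2.IsFunA A →
      LocalP2.IsContinuation LocalP2.genI11 I → LocalP2.IsContinuation LocalP2.genS S →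
      -- `ℚ[E₂(3τ), E₄(3τ), E₆(3τ)]` and `ℚ[A, B, C]` are graded by the weight
      DirectSum.IsInternal (LocalP2.genPart ![2, 4, 6] LocalP2.eisGens) ∧
      DirectSum.IsInternal (LocalP2.genPart ![1, 2, 3] ![A, LocalP2.funB, LocalP2.funC]) ∧
      -- the first is contained in the second, compatibly with the gradings
      (∃ h : LocalP2.genRing LocalP2.eisGens ≤
          LocalP2.genRing ![A, LocalP2.funB, LocalP2.funC],
        ∀ k : ℕ, ∀ x ∈ LocalP2.genPart ![2, 4, 6] LocalP2.eisGens k,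
          Subalgebra.inclusion h x ∈
            LocalP2.genPart ![1, 2, 3] ![A, LocalP2.funB, LocalP2.funC] k) ∧
      -- the identities in terms of `A`, `B`, `C`
      (∀ τ : ℍ,
        3 * LocalP2.eisenstein 1 (3 * τ) = 2 * LocalP2.funB τ + A τ ^ 2 ∧
        9 * LocalP2.eisenstein 2 (3 * τ) = A τ ^ 4 + 8 * A τ * LocalP2.funC τ ∧
        27 * LocalP2.eisenstein 3 (3 * τ) =
          -A τ ^ 6 + 20 * A τ ^ 3 * LocalP2.funC τ + 8 * LocalP2.funC τ ^ 2) ∧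
      -- the identities in terms of `X`, `I₁₁`, `S`
      (∀ τ : ℍ, ∀ X : ℂ, X = LocalP2.genX (LocalP2.coordQ τ) → X ≠ 0 →
        2 * LocalP2.funB τ + A τ ^ 2 = 3 * I τ ^ 2 / X * (X + 4 * S τ) ∧
        A τ ^ 4 + 8 * A τ * LocalP2.funC τ = I τ ^ 4 / X * (X + 8) ∧
        -A τ ^ 6 + 20 * A τ ^ 3 * LocalP2.funC τ + 8 * LocalP2.funC τ ^ 2 =
          -I τ ^ 6 / X ^ 2 * (X ^ 2 - 20 * X - 8)) := by
  refine ⟨⟨_, LocalP2.isFunA_discA, fun _ h => h.unique LocalP2.isFunA_discA⟩,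
    ⟨_, LocalP2.isContinuation_genI11, fun _ h => h.unique LocalP2.isContinuation_genI11⟩,
    ⟨_, LocalP2.isContinuation_genS, fun _ h => h.unique LocalP2.isContinuation_genS⟩,
    fun A I S hA hI hS => ?_⟩
  obtain rfl := hA.unique LocalP2.isFunA_discA
  obtain rfl := hI.unique LocalP2.isContinuation_genI11
  obtain rfl := hS.unique LocalP2.isContinuation_genS
  refine ⟨LocalP2.isInternal_genPart_eisGens, LocalP2.isInternal_genPart_abcGens,
    ⟨LocalP2.genRing_eisGens_le, fun _ _ hx => LocalP2.inclusion_mem_genPart_abcGens hx⟩,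
    fun τ => ?_, fun τ X hX hX0 => ?_⟩
  · have hz := LocalP2.nome_mem_ball τ.2
    rw [LocalP2.eisenstein_one_three, LocalP2.eisenstein_two_three, LocalP2.eisenstein_three_three,
      LocalP2.funB_eq, LocalP2.funC_eq]
    exact ⟨LocalP2.three_mul_discE2 hz, LocalP2.nine_mul_discE4 hz,
      LocalP2.twentySeven_mul_discE6 hz⟩
  · rw [LocalP2.funB_eq, LocalP2.funC_eq]
    exact LocalP2.generator_identities τ rfl rfl rfl hX hX0
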